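/- Conventions. A manifold with corners $X$ is a paracompact Hausdorff space that is locally diffeomorphic to open subsets of $[0,\infty)^k\times\mathbb R^{n-k}$, and whose boundary hypersurfaces are embedded: near each of its points a boundary hypersurface is the zero set of a single boundary coordinate. A boundary face of $X$ is the closure of a connected component of the set of points of a given boundary codimension; $\mathcal M(X)$ is the set of all boundary faces (including the components of $X$). Each face $F$ is itself a manifold with corners, with boundary $\partial F$. In local coordinates $(x,y)$, the b-tangent space ${}^bT_pX$ is spanned by the $x_i\partial_{x_i}$ and the $\partial_{y_j}$. An (interior) b-map $f:X\to Y$ is a smooth map of the local form $(x,y)\mapsto (x',y')$ with $x'_j=a_j(x,y)\prod_i x_i^{\alpha_{ij}}$, $y'=b(x,y)$, where $a_j>0$ is smooth and $\alpha_{ij}\in\{0,1,2,\dots\}$; its differential on the interior extends by continuity to the b-differential ${}^bf_*:{}^bT_pX\to{}^bT_{f(p)}Y$ for every $p \in X$. Let $Z$ be a manifold with corners. A local binomial structure on a closed subset $D\subset Z$ near $p\in D$ consists of a coordinate neighbourhood $U\ni p$ and functions $f_k=c_kx^{\gamma_k}$, $k=1,\dots,d$, with $0<c_k\in C^\infty(U)$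 and integer exponent vectors $\gamma_k$, such that the logarithmic differentials $df_k/f_k$ are linearly independent in ${}^bT^*_qZ$ at each $q\in D\cap U$ and $$D\cap U=\operatorname{clos}_U\{q\in U\setminus\partial U : f_k(q)=1,\ k=1,\dots,d\}.$$ A connected closed subset of $Z$ is an interior binomial subvariety if it has a local binomial structure near each of its points. Proposition. Let $X_1,X_2,Y$ be manifolds with corners and let $f_i:X_i\to Y$, $i=1,2$, be interior b-maps that are b-transversal: whenever $f_1(p_1)=f_2(p_2)=q$, $${}^b(f_1)_*({}^bT_{p_1}X_1)+{}^b(f_2)_*({}^bT_{p_2}X_2)={}^bT_qY.$$ For $F_i\in\mathcal M(X_i)$ put $F_1\times_YF_2=\{(p_1,p_2)\in F_1\times F_2: f_1(p_1)=f_2(p_2)\}$ and $$D(F_1,F_2)=\operatorname{clos}\big((F_1\times_YF_2)\setminus\partial(F_1\times F_2)\big)\subset F_1\times F_2.$$ Then $X_1\times_YX_2=\bigcup_{F_1\in\mathcal M(X_1),\,F_2\in\mathcal M(X_2)}D(F_1,F_2)$. Moreover, for all $F_1,F_2$ the closed set $D(F_1,F_2)\subset F_1\times F_2$ has a local binomial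 structure, as a subset of the manifold with corners $F_1\times F_2$, near each of its points, and each connected component of $D(F_1,F_2)$ is an interior binomial subvariety of $F_1\times F_2$. -/

import Mathlib

open Set Filter Topology
open scoped Manifold ContDiff

noncomputable section

namespace BFiber

/-! ### Models for manifolds with corners

A manifold with corners is a charted space over an orthant.  So that the same definitions apply to
`X` and to products `X₁ × X₂` (whose model in Mathlib is a product of models), we record for a model
with corners `I` linear coordinates on the model vector space in which the range of `I` is the
orthant `[0, ∞)^ι`.  The spaces `[0, ∞)^k × ℝ^(n-k)` are locally diffeomorphic to open subsets of
`[0, ∞)^n`; a coordinate that stays positive plays the role of an interior coordinate. -/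

/-- Linear coordinates in which the range of the model `I` is the orthant `[0, ∞)^ι`. -/
class CornerModel {E H : Type*} [NormedAddCommGroup E] [NormedSpace ℝ E] [TopologicalSpace H]
    (I : ModelWithCorners ℝ E H) (ι : outParam Type) [Fintype ι] where
  coord : E ≃L[ℝ] (ι → ℝ)
  range_eq : Set.range I = {v | ∀ i, 0 ≤ coord v i}

instance quadrantCornerModel (n : ℕ) :
    CornerModel (modelWithCornersEuclideanQuadrant n) (Fin n) where
  coord := EuclideanSpace.equiv (Fin n) ℝ
  range_eq := range_euclideanQuadrant n

instance prodCornerModel {E H E' H' : Type*} [NormedAddCommGroup E] [NormedSpace ℝ E]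
    [TopologicalSpace H] [NormedAddCommGroup E'] [NormedSpace ℝ E'] [TopologicalSpace H']
    (I : ModelWithCorners ℝ E H) (I' : ModelWithCorners ℝ E' H') {ι ι' : Type} [Fintype ι]
    [Fintype ι'] [c : CornerModel I ι] [c' : CornerModel I' ι'] :
    CornerModel (I.prod I') (ι ⊕ ι') where
  coord := (c.coord.prodCongr c'.coord).trans
    (ContinuousLinearEquiv.sumPiEquivProdPi ℝ ι ι' (fun _ => ℝ)).symm
  range_eq := by
    ext v
    rw [ModelWithCorners.range_prod, c.range_eq, c'.range_eq]
    constructor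
    · rintro ⟨h, h'⟩ (i | i)
      · exact h i
      · exact h' i
    · intro h
      exact ⟨fun i => h (Sum.inl i), fun i => h (Sum.inr i)⟩

section Basic

variable {E H M : Type*} [NormedAddCommGroup E] [NormedSpace ℝ E] [TopologicalSpace H]
  [TopologicalSpace M] [ChartedSpace H M] (I : ModelWithCorners ℝ E H)
  {ι : Type} [Fintype ι] [CornerModel I ι]

/-- The `i`-th coordinate function `x_i ≥ 0` of the chart `e`. -/
def xcoord (e : OpenPartialHomeomorph M H) (i : ι) (q : M) : ℝ :=
  CornerModel.coord (I := I) (e.extend I q) i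

open scoped Classical in
/-- The partial derivative `∂u/∂x_i` at `q` in the coordinates of the chart `e`. -/
def pderiv (e : OpenPartialHomeomorph M H) (u : M → ℝ) (i : ι) (q : M) : ℝ :=
  fderivWithin ℝ (u ∘ (e.extend I).symm) (Set.range I) (e.extend I q)
    ((CornerModel.coord (I := I)).symm (Pi.single i 1))

/-- The components of the logarithmic differential `d log (a x^γ) = d log a + ∑ γ_i dx_i/x_i` at `q`
with respect to the frame `dx_i/x_i` of the b-cotangent bundle given by the chart `e`: the `i`-th
component is `γ_i + x_i ∂_i a / a`.  Where `x_i ≠ 0`, `dx_i/x_i` is a nonzero multiple of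
`dx_i`. -/
def bLogDiff (e : OpenPartialHomeomorph M H) (a : M → ℝ) (γ : ι → ℤ) (q : M) : ι → ℝ :=
  fun i => (γ i : ℝ) + xcoord I e i q * pderiv I e a i q / a q

/-! ### Boundary faces -/

/-- The boundary codimension of `p`: the number of coordinates vanishing at `p`. -/
def bdryCodim (p : M) : ℕ := Set.ncard {i : ι | xcoord I (chartAt H p) i p = 0}

/-- `F` is a boundary face of codimension `k`: the closure of a connected component of the set of
points of codimension `k`. -/
def IsFaceOfCodim (k : ℕ) (F : Set M) : Prop :=
  ∃ p : M, bdryCodim I p = k ∧ F = closure (connectedComponentIn {q : M | bdryCodim I q = k} p)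

/-- The set of all boundary faces, of any codimension (in codimension `0`: the components). -/
def faces (M : Type*) [TopologicalSpace M] [ChartedSpace H M] : Set (Set M) :=
  {F | ∃ k, IsFaceOfCodim I k F}

/-- The boundary `∂F` of a face `F`, regarded as a manifold with corners: the points of `F` whose
codimension is not the smallest one on `F`. -/
def faceBoundary (F : Set M) : Set M := {q ∈ F | ∃ q' ∈ F, bdryCodim I q' < bdryCodim I q}

/-- Boundary hypersurfaces are embedded: near each of its points, a boundary hypersurface is the
zero set of a single coordinate. -/
def HasEmbeddedHypersurfaces (M : Type*) [TopologicalSpace M] [ChartedSpace H M] : Prop :=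
  ∀ F : Set M, IsFaceOfCodim I 1 F → ∀ p ∈ F, ∃ e ∈ IsManifold.maximalAtlas I ∞ M,
    p ∈ e.source ∧ ∃ i : ι, F ∩ e.source = {q ∈ e.source | xcoord I e i q = 0}

/-! ### Interior binomial subvarieties -/

/-- `D` has a local binomial structure near `p`, as a subset of the boundary face `G` of `M`, where
`G` is regarded as a manifold with corners (`G` may also be all of `M`).

There is a chart `e` of `M` around `p`, with domain `U`, in which `G ∩ U` is given by the vanishing
of the coordinates `x_j`, `j ∈ J`; the other coordinates then restrict to a chart of `G`.
The functions `f_k = a_k x^{γ_k}`, with `a_k > 0` smooth and `x^{γ_k}` a Laurent monomial in the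
coordinates of `G`, have independent logarithmic differentials at each point of `D ∩ U`, and
`D ∩ U` is the closure in `U` of the set of interior points of `G ∩ U` at which all `f_k` are `1`.
At points of `G` the components of `d log f_k` with index in `J` vanish, so that independence in
`ℝ^ι` is independence in the b-cotangent space of `G`. -/
def HasLocalBinomialStructureAt (G D : Set M) (p : M) : Prop :=
  ∃ e ∈ IsManifold.maximalAtlas I ∞ M, p ∈ e.source ∧
    ∃ J : Set ι, G ∩ e.source = {q ∈ e.source | ∀ j ∈ J, xcoord I e j q = 0} ∧
    ∃ (d : ℕ) (a : Fin d → M → ℝ) (γ : Fin d → ι → ℤ),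
      (∀ k, ContMDiffOn I 𝓘(ℝ, ℝ) ∞ (a k) e.source) ∧
      (∀ k, ∀ q ∈ e.source, 0 < a k q) ∧
      (∀ k, ∀ j ∈ J, γ k j = 0) ∧
      (∀ q ∈ D ∩ e.source, LinearIndependent ℝ (fun k => bLogDiff I e (a k) (γ k) q)) ∧
      D ∩ e.source =
        closure {q | q ∈ G ∩ e.source ∧ (∀ i, i ∉ J → 0 < xcoord I e i q) ∧
          ∀ k, a k q * ∏ i, xcoord I e i q ^ γ k i = 1} ∩ e.source

/-- `D` is an interior binomial subvariety of the boundary face `G` of `M`: a connected closed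
subset of `G` covered by local binomial structures. -/
structure IsInteriorBinomialSubvariety (G D : Set M) : Prop where
  subset : D ⊆ G
  isClosed : IsClosed D
  isConnected : IsConnected D
  local_structure : ∀ p ∈ D, HasLocalBinomialStructureAt I G D p

/-- The b-tangent space at `p`, in the frame `x_i ∂/∂x_i` given by the preferred chart at `p`.
Where `x_i ≠ 0`, `x_i ∂/∂x_i` is a nonzero multiple of `∂/∂x_i`. -/
abbrev BTangentSpace {E H M : Type*} [NormedAddCommGroup E] [NormedSpace ℝ E] [TopologicalSpace H]
    (I : ModelWithCorners ℝ E H) {ι : Type} [Fintype ι] [CornerModel I ι] (_p : M) : Type :=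
  ι → ℝ

end Basic

/-! ### b-maps and b-transversality -/

section Maps

variable {E H M E' H' M' : Type*} [NormedAddCommGroup E] [NormedSpace ℝ E] [TopologicalSpace H]
  [TopologicalSpace M] [ChartedSpace H M] (I : ModelWithCorners ℝ E H)
  {ι : Type} [Fintype ι] [CornerModel I ι]
  [NormedAddCommGroup E'] [NormedSpace ℝ E'] [TopologicalSpace H']
  [TopologicalSpace M'] [ChartedSpace H' M'] (I' : ModelWithCorners ℝ E' H')
  {ι' : Type} [Fintype ι'] [CornerModel I' ι']

/-- Near `p`, in the preferred charts at `p` and `f p`, the map `f` is given by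
`x'_j = a_j(x) ∏ x_i^{α_{ji}}` with `a_j > 0` smooth.  (For a coordinate `x'_j` that is positive at
`f p` this only says that it pulls back to a smooth function: then `α_{ji} = 0` if
`x_i(p) = 0`.) -/
def HasBLocalForm (f : M → M') (p : M) (α : ι' → ι → ℕ) (a : ι' → M → ℝ) : Prop :=
  ∀ᶠ q in 𝓝 p, ∀ j : ι', ContMDiffAt I 𝓘(ℝ, ℝ) ∞ (a j) q ∧ 0 < a j q ∧
    xcoord I' (chartAt H' (f p)) j (f q) = a j q * ∏ i, xcoord I (chartAt H p) i q ^ α j i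

/-- Interior b-maps: smooth maps pulling back each local boundary defining function to a product of
powers of boundary defining functions and a positive smooth function. -/
structure IsInteriorBMap (f : M → M') : Prop where
  contMDiff : ContMDiff I I' ∞ f
  local_form : ∀ p, ∃ (α : ι' → ι → ℕ) (a : ι' → M → ℝ), HasBLocalForm I I' f p α a

/-- `L` is the b-differential of `f` at `p`, i.e. the continuous extension to `p` of the
differential of `f` at interior points: `x_i ∂/∂x_i ↦ ∑_j (α_{ji} + x_i ∂_i a_j / a_j) x'_j ∂/∂x'_j`
if `f` has the local form `x'_j = a_j x^{α_j}` near `p`. -/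
def HasBDifferentialAt (f : M → M') (p : M)
    (L : BTangentSpace I p →ₗ[ℝ] BTangentSpace I' (f p)) : Prop :=
  ∃ (α : ι' → ι → ℕ) (a : ι' → M → ℝ), HasBLocalForm I I' f p α a ∧
    ∀ v j, L v j = ∑ i, bLogDiff I (chartAt H p) (a j) (fun i => (α j i : ℤ)) p i * v i

end Maps

section Transversality

variable {E₁ H₁ X₁ E₂ H₂ X₂ E H Y : Type*}
  [NormedAddCommGroup E₁] [NormedSpace ℝ E₁] [TopologicalSpace H₁]
  [TopologicalSpace X₁] [ChartedSpace H₁ X₁] (I₁ : ModelWithCorners ℝ E₁ H₁)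
  {ι₁ : Type} [Fintype ι₁] [CornerModel I₁ ι₁]
  [NormedAddCommGroup E₂] [NormedSpace ℝ E₂] [TopologicalSpace H₂]
  [TopologicalSpace X₂] [ChartedSpace H₂ X₂] (I₂ : ModelWithCorners ℝ E₂ H₂)
  {ι₂ : Type} [Fintype ι₂] [CornerModel I₂ ι₂]
  [NormedAddCommGroup E] [NormedSpace ℝ E] [TopologicalSpace H]
  [TopologicalSpace Y] [ChartedSpace H Y] (I : ModelWithCorners ℝ E H)
  {ι : Type} [Fintype ι] [CornerModel I ι]

/-- b-transversality of two interior b-maps: the ranges of the b-differentials at points with the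
same image `q` together span the b-tangent space at `q`. -/
def BTransversal (f₁ : X₁ → Y) (f₂ : X₂ → Y) : Prop :=
  ∀ p₁ p₂, f₁ p₁ = f₂ p₂ →
    ∀ (L₁ : BTangentSpace I₁ p₁ →ₗ[ℝ] BTangentSpace I (f₁ p₁))
      (L₂ : BTangentSpace I₂ p₂ →ₗ[ℝ] BTangentSpace I (f₂ p₂)),
      HasBDifferentialAt I₁ I f₁ p₁ L₁ → HasBDifferentialAt I₂ I f₂ p₂ L₂ →
        LinearMap.range L₁ ⊔ LinearMap.range L₂ = ⊤

/-- The set-theoretic fiber product `F₁ ×_Y F₂` of subsets of `X₁`, `X₂`. -/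
def fiberProduct (f₁ : X₁ → Y) (f₂ : X₂ → Y) (F₁ : Set X₁) (F₂ : Set X₂) : Set (X₁ × X₂) :=
  {p ∈ F₁ ×ˢ F₂ | f₁ p.1 = f₂ p.2}

/-- `D(F₁, F₂)`, the closure of `(F₁ ×_Y F₂) \ ∂(F₁ × F₂)`. -/
def fiberComponent (f₁ : X₁ → Y) (f₂ : X₂ → Y) (F₁ : Set X₁) (F₂ : Set X₂) : Set (X₁ × X₂) :=
  closure (fiberProduct f₁ f₂ F₁ F₂ \ faceBoundary (I₁.prod I₂) (F₁ ×ˢ F₂))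

end Transversality

end BFiber

end

notation "𝓠" => modelWithCornersEuclideanQuadrant

namespace BFiber

/-! Near a point p of D(F₁, F₂), write f₁ as y_j = a_j x^{α_j} and f₂ as y_j = b_j z^{β_j} in
charts. In the interior of F₁ × F₂ exactly the coordinates in J₁ and J₂ vanish, so there each y_j ∘
f₁ vanishes identically or nowhere, and so does each y_j ∘ f₂. Since p is a limit of interior points
with f₁ = f₂, both maps have the same set of vanishing j. For these j the equation reads 0 = 0; for
the others it is the binomial equation (a_j/b_j) x^{α_j} z^{-β_j} = 1, whose monomial avoids J₁ and
J₂. The logarithmic differentials at p are the rows of the matrix of the two b-differentials, the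
second with a minus sign; they are independent by b-transversality
(`BTransversal.linearIndependent`), and independence is an open condition. This gives
`hasLocalBinomialStructureAt_fiberComponent`.

The argument needs faces to be coordinate faces locally. By `exists_coord_of_zero` any two charts
match their boundary coordinates, so codimension is independent of the chart; embedded hypersurfaces
then give `HasEmbeddedHypersurfaces.exists_face_coords`. The union formula holds because (p₁, p₂) is
interior to F₁ × F₂ when F_i is the face through p_i of the codimension of p_i.

A connected component of D inherits the local structure once it agrees with D near each of its
points. In coordinates t = log x the equations are linear, with coefficients the b-differential at
the base point, plus a remainder whose Lipschitz constant is small on a box reaching to t = -∞. A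
perturbation of the identity straightens the solutions to a convex set
(`isPreconnected_perturbed_solutions`), so the interior solutions near p lie in one connected set of
solutions (`HasLocalBinomialStructureAt.connectedComponentIn`). -/

/-- The closed orthant `[0, ∞)^ι`. -/
def orthant (ι : Type*) : Set (ι → ℝ) := {x | ∀ i, 0 ≤ x i}

lemma convex_orthant (ι : Type*) : Convex ℝ (orthant ι) := by
  intro x hx y hy a b ha hb _ i
  exact add_nonneg (mul_nonneg ha (hx i)) (mul_nonneg hb (hy i))

lemma uniqueDiffOn_orthant (ι : Type*) [Fintype ι] : UniqueDiffOn ℝ (orthant ι) := by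
  have h : orthant ι = Set.pi univ fun _ : ι => Ici (0 : ℝ) := by
    ext x
    simp only [orthant, mem_ofPred_eq, Set.mem_pi, mem_univ, forall_const, mem_Ici]
  rw [h]
  exact UniqueDiffOn.univ_pi fun _ => uniqueDiffOn_Ici 0

/-- Near a point of the orthant, there are points where exactly the coordinates of a given set of
vanishing coordinates vanish. -/
lemma frequently_zeroSet {ι : Type*} [Finite ι] {x : ι → ℝ} (hx : x ∈ orthant ι) {J : Set ι}
    (hJ : ∀ j ∈ J, x j = 0) :
    ∃ᶠ y in 𝓝[orthant ι] x, ∀ l, y l = 0 ↔ l ∈ J := by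
  classical
  -- Push x inward by t in every direction outside J.
  let c : ℝ → ι → ℝ := fun t l => x l + if l ∈ J then 0 else t
  have hc : Tendsto c (𝓝[>] 0) (𝓝[orthant ι] x) := by
    apply tendsto_nhdsWithin_iff.2 ⟨?_, ?_⟩
    · have : Continuous c := by
        refine continuous_pi fun l => ?_
        by_cases h : l ∈ J <;> simp [c, h] <;> fun_prop
      have h0 : c 0 = x := by ext l; simp [c]
      have := this.tendsto 0
      rw [h0] at this
      exact this.mono_left nhdsWithin_le_nhds
    · filter_upwards [self_mem_nhdsWithin] with t ht l
      have := hx l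
      have ht' : (0 : ℝ) < t := ht
      dsimp only [c]; split_ifs <;> linarith
  refine hc.frequently (Eventually.frequently ?_)
  filter_upwards [self_mem_nhdsWithin] with t ht l
  have := hx l
  have ht' : (0 : ℝ) < t := ht
  dsimp only [c]
  by_cases h : l ∈ J
  · simp [h, hJ l h]
  · simp only [h, if_false, iff_false]; linarith

/-! ### Charts as maps to the orthant. -/

section Coordinates

variable {E H M : Type*} [NormedAddCommGroup E] [NormedSpace ℝ E] [TopologicalSpace H]
  [TopologicalSpace M] (I : ModelWithCorners ℝ E H) {ι : Type} [Fintype ι] [CornerModel I ι]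

/-- The coordinate map of the chart `e`, with values in the orthant. -/
noncomputable def cmap (e : OpenPartialHomeomorph M H) (q : M) : ι → ℝ := fun i => xcoord I e i q

/-- The inverse of the coordinate map of the chart `e`. -/
noncomputable def cinv (e : OpenPartialHomeomorph M H) (x : ι → ℝ) : M :=
  (e.extend I).symm ((CornerModel.coord (I := I)).symm x)

lemma cmap_eq (e : OpenPartialHomeomorph M H) (q : M) :
    cmap I e q = CornerModel.coord (I := I) (e.extend I q) := rfl

lemma orthant_eq_preimage :
    orthant ι = (CornerModel.coord (I := I)).symm ⁻¹' range I := by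
  ext x
  simp [orthant, CornerModel.range_eq (I := I)]

lemma cmap_mem_orthant (e : OpenPartialHomeomorph M H) (q : M) : cmap I e q ∈ orthant ι := by
  rw [orthant_eq_preimage I, mem_preimage, cmap_eq, ContinuousLinearEquiv.symm_apply_apply]
  exact mem_range_self _

lemma xcoord_nonneg (e : OpenPartialHomeomorph M H) (i : ι) (q : M) : 0 ≤ xcoord I e i q :=
  cmap_mem_orthant I e q i

lemma cinv_cmap {e : OpenPartialHomeomorph M H} {q : M} (hq : q ∈ e.source) :
    cinv I e (cmap I e q) = q := by
  rw [cinv, cmap_eq, ContinuousLinearEquiv.symm_apply_apply, e.extend_left_inv hq]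

/-- An equality of filters, so that both "eventually" and "frequently" transfer in either direction
between the manifold and the orthant. -/
lemma map_cmap_nhds {e : OpenPartialHomeomorph M H} {p : M} (hp : p ∈ e.source) :
    map (cmap I e) (𝓝 p) = 𝓝[orthant ι] (cmap I e p) := by
  have h1 : cmap I e = (CornerModel.coord (I := I)) ∘ (e.extend I) := rfl
  rw [h1, ← Filter.map_map, e.map_extend_nhds hp, orthant_eq_preimage I]
  have := (CornerModel.coord (I := I)).toHomeomorph.isEmbedding.map_nhdsWithin_eq
    (range I) (e.extend I p)
  rw [show (CornerModel.coord (I := I)).symm ⁻¹' range I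
    = (CornerModel.coord (I := I)) '' range I from
    ((CornerModel.coord (I := I)).toEquiv.image_eq_preimage_symm _).symm]
  exact this

lemma continuousAt_cmap {e : OpenPartialHomeomorph M H} {p : M} (hp : p ∈ e.source) :
    ContinuousAt (cmap I e) p := by
  rw [ContinuousAt, Tendsto, map_cmap_nhds I hp]
  exact nhdsWithin_le_nhds

lemma tendsto_cmap {e : OpenPartialHomeomorph M H} {p : M} (hp : p ∈ e.source) :
    Tendsto (cmap I e) (𝓝 p) (𝓝[orthant ι] (cmap I e p)) :=
  (map_cmap_nhds I hp).le

lemma continuousAt_xcoord {e : OpenPartialHomeomorph M H} {p : M} (hp : p ∈ e.source) (i : ι) :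
    ContinuousAt (xcoord I e i) p :=
  (continuousAt_pi.1 (continuousAt_cmap I hp)) i

lemma eventually_cmap_cinv {e : OpenPartialHomeomorph M H} {p : M} (hp : p ∈ e.source) :
    ∀ᶠ x in 𝓝[orthant ι] (cmap I e p), cmap I e (cinv I e x) = x ∧ cinv I e x ∈ e.source := by
  rw [← map_cmap_nhds I hp, eventually_map]
  filter_upwards [e.open_source.mem_nhds hp] with q hq
  rw [cinv_cmap I hq]
  exact ⟨rfl, hq⟩

lemma tendsto_cinv {e : OpenPartialHomeomorph M H} {p : M} (hp : p ∈ e.source) :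
    Tendsto (cinv I e) (𝓝[orthant ι] (cmap I e p)) (𝓝 p) := by
  rw [← map_cmap_nhds I hp, tendsto_map'_iff]
  refine tendsto_id.congr' ?_
  filter_upwards [e.open_source.mem_nhds hp] with q hq
  exact (cinv_cmap I hq).symm

lemma frequently_zeroSet_xcoord {e : OpenPartialHomeomorph M H} {p : M} (hp : p ∈ e.source)
    {J : Set ι} (hJ : ∀ j ∈ J, xcoord I e j p = 0) :
    ∃ᶠ q in 𝓝 p, ∀ l, xcoord I e l q = 0 ↔ l ∈ J := by
  have := frequently_zeroSet (cmap_mem_orthant I e p) hJ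
  rw [← map_cmap_nhds I hp, frequently_map] at this
  exact this

open scoped Classical in
lemma pderiv_eq (e : OpenPartialHomeomorph M H) (u : M → ℝ) (i : ι) (q : M) :
    pderiv I e u i q =
      fderivWithin ℝ (u ∘ cinv I e) (orthant ι) (cmap I e q) (Pi.single i 1) := by
  have h : u ∘ cinv I e = (u ∘ (e.extend I).symm) ∘ (CornerModel.coord (I := I)).symm := rfl
  have hu := uniqueDiffOn_orthant ι _ (cmap_mem_orthant I e q)
  rw [orthant_eq_preimage I] at hu ⊢
  rw [h, ContinuousLinearEquiv.comp_right_fderivWithin _ hu, pderiv, cmap_eq,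
    ContinuousLinearEquiv.symm_apply_apply]
  rfl

variable [ChartedSpace H M]

lemma contDiffWithinAt_comp_cinv {e : OpenPartialHomeomorph M H}
    (he : e ∈ IsManifold.maximalAtlas I ∞ M) [IsManifold I ∞ M] {q : M} (hq : q ∈ e.source)
    {u : M → ℝ} (hu : ContMDiffAt I 𝓘(ℝ, ℝ) ∞ u q) :
    ContDiffWithinAt ℝ ∞ (u ∘ cinv I e) (orthant ι) (cmap I e q) := by
  rw [← contMDiffWithinAt_univ, contMDiffWithinAt_iff_source_of_mem_maximalAtlas he hq,
    contMDiffWithinAt_iff_contDiffWithinAt, preimage_univ, univ_inter] at hu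
  have h : u ∘ cinv I e = (u ∘ (e.extend I).symm) ∘ (CornerModel.coord (I := I)).symm := rfl
  rw [h, orthant_eq_preimage I]
  refine ContDiffWithinAt.comp _ (t := range I) ?_
    (CornerModel.coord (I := I)).symm.contDiff.contDiffWithinAt (mapsTo_preimage _ _)
  rw [cmap_eq, ContinuousLinearEquiv.symm_apply_apply]
  exact hu

lemma contMDiffAt_xcoord {e : OpenPartialHomeomorph M H}
    (he : e ∈ IsManifold.maximalAtlas I ∞ M) {q : M} (hq : q ∈ e.source) (i : ι) :
    ContMDiffAt I 𝓘(ℝ, ℝ) ∞ (xcoord I e i) q := by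
  have h1 : ContMDiffAt I 𝓘(ℝ, E) ∞ (e.extend I) q :=
    OpenPartialHomeomorph.contMDiffAt_extend he hq
  have h2 : ContDiff ℝ ∞ (fun v : E => CornerModel.coord (I := I) v i) :=
    contDiff_pi.1 (CornerModel.coord (I := I)).contDiff i
  exact (h2.contMDiff.contMDiffAt).comp q h1

lemma continuousAt_pderiv {e : OpenPartialHomeomorph M H}
    (he : e ∈ IsManifold.maximalAtlas I ∞ M) [IsManifold I ∞ M] {p : M} (hp : p ∈ e.source)
    {u : M → ℝ} (hu : ContMDiffAt I 𝓘(ℝ, ℝ) ∞ u p) (i : ι) :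
    ContinuousAt (pderiv I e u i) p := by
  classical
  have h := (contDiffWithinAt_comp_cinv I he hp hu).fderivWithin_right (m := 0)
    (uniqueDiffOn_orthant ι) (by simp) (cmap_mem_orthant I e p)
  have h2 := h.continuousWithinAt.tendsto.comp (tendsto_cmap I hp)
  have h3 := ((ContinuousLinearMap.apply ℝ ℝ (Pi.single i (1 : ℝ) : ι → ℝ)).continuous.tendsto
    _).comp h2
  have h4 : pderiv I e u i = fun q =>
    fderivWithin ℝ (u ∘ cinv I e) (orthant ι) (cmap I e q) (Pi.single i 1) := by
    funext q
    rw [pderiv_eq]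
  rw [ContinuousAt, h4]
  exact h3

/-- Since linear independence is open, this spreads independence from a point to a neighbourhood. -/
lemma continuousAt_bLogDiff {e : OpenPartialHomeomorph M H}
    (he : e ∈ IsManifold.maximalAtlas I ∞ M) [IsManifold I ∞ M] {p : M} (hp : p ∈ e.source)
    {a : M → ℝ} (ha : ContMDiffAt I 𝓘(ℝ, ℝ) ∞ a p) (h0 : a p ≠ 0) (γ : ι → ℤ) :
    ContinuousAt (bLogDiff I e a γ) p := by
  refine continuousAt_pi.2 fun i => ?_
  exact continuousAt_const.add
    (((continuousAt_xcoord I hp i).mul (continuousAt_pderiv I he hp ha i)).div ha.continuousAt h0)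

end Coordinates

/-- A nonnegative smooth function on the orthant which vanishes at `x₀` to first order only, has zeros
near `x₀` only where some coordinate vanishing at `x₀` is zero. -/
lemma exists_coord_of_zero {ι : Type*} [Fintype ι] {g : (ι → ℝ) → ℝ} {x₀ : ι → ℝ}
    (hx₀ : x₀ ∈ orthant ι) (hg : ContDiffWithinAt ℝ ∞ g (orthant ι) x₀)
    (hnn : ∀ x, 0 ≤ g x) (h0 : g x₀ = 0) (hd : fderivWithin ℝ g (orthant ι) x₀ ≠ 0) :
    ∃ j, x₀ j = 0 ∧ ∀ᶠ x in 𝓝[orthant ι] x₀, g x = 0 → x j = 0 := by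
  classical
  obtain ⟨j, hj⟩ : ∃ j, fderivWithin ℝ g (orthant ι) x₀ (Pi.single j 1) ≠ 0 := by
    by_contra! h
    refine hd (ContinuousLinearMap.coe_injective ?_)
    refine LinearMap.pi_ext' fun i => LinearMap.ext_ring ?_
    exact h i
  set D : (ι → ℝ) → ℝ := fun x => fderivWithin ℝ g (orthant ι) x (Pi.single j 1) with hD
  have hDc : ContinuousWithinAt D (orthant ι) x₀ := by
    have h := (hg.fderivWithin_right (m := 0) (uniqueDiffOn_orthant ι) (by simp) hx₀)
    exact ((ContinuousLinearMap.apply ℝ ℝ (Pi.single j (1 : ℝ) : ι → ℝ)).continuous.tendsto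
      _).comp h.continuousWithinAt.tendsto
  have hdiff : ∀ᶠ x in 𝓝[orthant ι] x₀, DifferentiableWithinAt ℝ g (orthant ι) x := by
    have h1 : ContDiffWithinAt ℝ 1 g (orthant ι) x₀ := hg.of_le (by simp)
    have := h1.eventually (by simp)
    rw [insert_eq_of_mem hx₀] at this
    filter_upwards [this] with x hx using hx.differentiableWithinAt (by simp)
  -- Mean value theorem along the j-th axis, inside the convex intersection of the orthant with a
  -- ball.
  have hmv : ∀ s : Set ℝ, s ∈ 𝓝 (D x₀) → ∃ r > 0, ∀ x ∈ orthant ι, ∀ t : ℝ, dist x x₀ < r →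
      x + Pi.single j t ∈ orthant ι → dist (x + Pi.single j t) x₀ < r →
        ∃ d ∈ s, g (x + Pi.single j t) - g x = t * d := by
    intro s hs
    have h1 : ∀ᶠ x in 𝓝[orthant ι] x₀, D x ∈ s ∧ DifferentiableWithinAt ℝ g (orthant ι) x :=
      (hDc.eventually hs).and hdiff
    obtain ⟨r, hr, hr'⟩ := Metric.eventually_nhds_iff.1 (eventually_nhdsWithin_iff.1 h1)
    refine ⟨r, hr, fun x hx t hxr hxt hxtr => ?_⟩
    obtain ⟨z, hz, hz'⟩ := domain_mvt (s := orthant ι ∩ Metric.ball x₀ r) (f := g)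
      (f' := fun x => fderivWithin ℝ g (orthant ι) x)
      (fun y hy => ((hr' hy.2 hy.1).2.hasFDerivWithinAt).mono inter_subset_left)
      ((convex_orthant ι).inter (convex_ball _ _)) ⟨hx, hxr⟩ ⟨hxt, hxtr⟩
    have hzs := ((convex_orthant ι).inter (convex_ball x₀ r)).segment_subset
      ⟨hx, hxr⟩ ⟨hxt, hxtr⟩ hz
    refine ⟨D z, (hr' hzs.2 hzs.1).1, ?_⟩
    rw [hz', add_sub_cancel_left, hD]
    have : (Pi.single j t : ι → ℝ) = t • Pi.single j 1 := by
      rw [← Pi.single_smul]; simp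
    rw [this, map_smul, smul_eq_mul]
  have hdist : ∀ t : ℝ, dist (x₀ + Pi.single j t) x₀ = |t| := fun t => by
    rw [dist_eq_norm, add_sub_cancel_left, Pi.norm_single, Real.norm_eq_abs]
  -- With a negative derivative, moving inward from the zero x₀ would make g negative.
  have hpos : 0 < D x₀ := by
    rcases lt_or_gt_of_ne hj with h | h
    · obtain ⟨r, hr, hr'⟩ := hmv (Iio 0) (Iio_mem_nhds h)
      obtain ⟨d, hd, he⟩ := hr' x₀ hx₀ (r / 2) (by simpa using hr)
        (fun i => add_nonneg (hx₀ i) (by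
          by_cases hi : i = j
          · subst hi; simp; linarith
          · simp [hi]))
        (by rw [hdist, abs_of_pos (half_pos hr)]; exact half_lt_self hr)
      have hn := hnn (x₀ + Pi.single j (r / 2))
      have hd' : d < 0 := hd
      nlinarith
    · exact h
  obtain ⟨r, hr, hr'⟩ := hmv (Ioi 0) (Ioi_mem_nhds hpos)
  -- The derivative is positive near x₀, so at a zero of g any room to decrease the j-th coordinate
  -- would produce a negative value.
  have hdec : ∀ x ∈ orthant ι, ∀ t : ℝ, 0 < t → t ≤ x j → dist x x₀ < r →
      dist (x + Pi.single j (-t)) x₀ < r → g x ≠ 0 := by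
    intro x hx t ht htx hxr hxtr h
    obtain ⟨d, hd, he⟩ := hr' x hx (-t) hxr (fun i => by
          by_cases hi : i = j
          · subst hi; simp; linarith
          · simpa [hi] using hx i) hxtr
    have hn := hnn (x + Pi.single j (-t))
    have hd' : 0 < d := hd
    nlinarith
  have hj0 : x₀ j = 0 := by
    by_contra hne
    have hlt : 0 < x₀ j := lt_of_le_of_ne (hx₀ j) (Ne.symm hne)
    have hm : 0 < min (x₀ j) (r / 2) := lt_min hlt (half_pos hr)
    refine hdec x₀ hx₀ (min (x₀ j) (r / 2)) hm (min_le_left _ _) (by simpa using hr) ?_ h0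
    have := min_le_right (x₀ j) (r / 2)
    rw [hdist, abs_neg, abs_of_pos hm]
    linarith
  refine ⟨j, hj0, ?_⟩
  filter_upwards [self_mem_nhdsWithin, nhdsWithin_le_nhds (Metric.ball_mem_nhds x₀ hr)]
    with x hx hxr hgx
  by_contra hne
  have hlt : 0 < x j := lt_of_le_of_ne (hx j) (Ne.symm hne)
  refine hdec x hx (x j) hlt le_rfl hxr ?_ hgx
  rw [dist_pi_lt_iff hr]
  intro i
  by_cases hi : i = j
  · subst hi; simp [hj0, hr]
  · have := (dist_pi_lt_iff hr).1 hxr i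
    simpa [hi] using this

/-! ### Matching boundary coordinates of two charts. -/

section CoordinateChange

variable {E H M : Type*} [NormedAddCommGroup E] [NormedSpace ℝ E] [TopologicalSpace H]
  [TopologicalSpace M] (I : ModelWithCorners ℝ E H) {ι : Type} [Fintype ι] [CornerModel I ι]

/-- Arbitrarily close to p there are points where x_i vanishes and no other coordinate does. -/
lemma eq_of_xcoord_eq_zero_imp {e : OpenPartialHomeomorph M H} {p : M} (hp : p ∈ e.source)
    {i j : ι} (hi : xcoord I e i p = 0)
    (h : ∀ᶠ q in 𝓝 p, xcoord I e i q = 0 → xcoord I e j q = 0) : j = i := by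
  obtain ⟨q, hq, hq'⟩ := ((frequently_zeroSet_xcoord I hp (J := {i})
    (by simpa using hi)).and_eventually h).exists
  exact (hq j).1 (hq' ((hq i).2 rfl))

variable [ChartedSpace H M] [IsManifold I ∞ M]

/-- Read in the chart e', the function x_i is nonnegative and smooth with nonzero differential at p,
so `exists_coord_of_zero` applies. -/
lemma exists_xcoord_of_xcoord_eq_zero {e e' : OpenPartialHomeomorph M H}
    (he : e ∈ IsManifold.maximalAtlas I ∞ M) (he' : e' ∈ IsManifold.maximalAtlas I ∞ M)
    {p : M} (hp : p ∈ e.source) (hp' : p ∈ e'.source) {i : ι} (hi : xcoord I e i p = 0) :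
    ∃ j, xcoord I e' j p = 0 ∧ ∀ᶠ q in 𝓝 p, xcoord I e i q = 0 → xcoord I e' j q = 0 := by
  classical
  have hg := contDiffWithinAt_comp_cinv I he' hp' (contMDiffAt_xcoord I he hp i)
  -- If the differential were zero, composing with the change of charts would give the linear
  -- function y ↦ y i zero derivative on the orthant, contradicting uniqueness of derivatives there.
  have hd : fderivWithin ℝ (xcoord I e i ∘ cinv I e') (orthant ι) (cmap I e' p) ≠ 0 := by
    intro h0
    have h2 : DifferentiableWithinAt ℝ (fun y => cmap I e' (cinv I e y)) (orthant ι)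
        (cmap I e p) := by
      refine differentiableWithinAt_pi.2 fun j => ?_
      exact (contDiffWithinAt_comp_cinv I he hp
        (contMDiffAt_xcoord I he' hp' j)).differentiableWithinAt (by simp)
    have h3 := h2.hasFDerivWithinAt
    have h1 : HasFDerivWithinAt (xcoord I e i ∘ cinv I e') (0 : (ι → ℝ) →L[ℝ] ℝ) (orthant ι)
        (cmap I e' (cinv I e (cmap I e p))) := by
      rw [cinv_cmap I hp, ← h0]
      exact (hg.differentiableWithinAt (by simp)).hasFDerivWithinAt
    have h4 := HasFDerivWithinAt.comp (cmap I e p) h1 h3 (fun y _ => cmap_mem_orthant I e' _)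
    rw [ContinuousLinearMap.zero_comp] at h4
    have h5 : HasFDerivWithinAt (fun y : ι → ℝ => y i) (0 : (ι → ℝ) →L[ℝ] ℝ) (orthant ι)
        (cmap I e p) := by
      refine h4.congr_of_eventuallyEq ?_ ?_
      · have hs : ∀ᶠ y in 𝓝[orthant ι] (cmap I e p), cinv I e y ∈ e'.source :=
          (tendsto_cinv I hp).eventually (e'.open_source.mem_nhds hp')
        filter_upwards [eventually_cmap_cinv I hp, hs] with y hy hys
        simp only [Function.comp, cinv_cmap I hys]
        exact (congrFun hy.1 i).symm
      · simp only [Function.comp, cinv_cmap I hp, cinv_cmap I hp']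
        rfl
    have h6 := (hasFDerivWithinAt_apply (𝕜 := ℝ) i (cmap I e p) (orthant ι)).congr_fderiv rfl
    have h7 := (uniqueDiffOn_orthant ι _ (cmap_mem_orthant I e p)).eq h5 h6
    have := DFunLike.congr_fun h7 (Pi.single i 1)
    simp at this
  obtain ⟨j, hj, hev⟩ := exists_coord_of_zero (cmap_mem_orthant I e' p) hg
    (fun x => xcoord_nonneg I e i _) (by simp [cinv_cmap I hp', hi]) hd
  refine ⟨j, hj, ?_⟩
  rw [← map_cmap_nhds I hp', eventually_map] at hev
  filter_upwards [hev, e'.open_source.mem_nhds hp'] with q hq hqs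
  rw [Function.comp, cinv_cmap I hqs] at hq
  exact hq

/-- Passing to e' and back to e must return to i, so both inclusions of zero sets are equalities
near p. -/
lemma exists_xcoord_eq_zero_iff {e e' : OpenPartialHomeomorph M H}
    (he : e ∈ IsManifold.maximalAtlas I ∞ M) (he' : e' ∈ IsManifold.maximalAtlas I ∞ M)
    {p : M} (hp : p ∈ e.source) (hp' : p ∈ e'.source) {i : ι} (hi : xcoord I e i p = 0) :
    ∃ j, xcoord I e' j p = 0 ∧ ∀ᶠ q in 𝓝 p, xcoord I e i q = 0 ↔ xcoord I e' j q = 0 := by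
  obtain ⟨j, hj, h⟩ := exists_xcoord_of_xcoord_eq_zero I he he' hp hp' hi
  obtain ⟨l, hl, h'⟩ := exists_xcoord_of_xcoord_eq_zero I he' he hp' hp hj
  obtain rfl : l = i := eq_of_xcoord_eq_zero_imp I hp hi (by
    filter_upwards [h, h'] with q h1 h2 using h2 ∘ h1)
  exact ⟨j, hj, by filter_upwards [h, h'] with q h1 h2 using ⟨h1, h2⟩⟩

/-- Matching coordinates is injective: the germ of its zero set determines a coordinate. -/
lemma ncard_xcoord_eq_zero_le {e e' : OpenPartialHomeomorph M H}
    (he : e ∈ IsManifold.maximalAtlas I ∞ M) (he' : e' ∈ IsManifold.maximalAtlas I ∞ M)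
    {p : M} (hp : p ∈ e.source) (hp' : p ∈ e'.source) :
    {i : ι | xcoord I e i p = 0}.ncard ≤ {i : ι | xcoord I e' i p = 0}.ncard := by
  have h := fun i (hi : xcoord I e i p = 0) => exists_xcoord_eq_zero_iff I he he' hp hp' hi
  choose! σ hσ hσ' using h
  refine ncard_le_ncard_of_injOn σ hσ ?_ (toFinite _)
  intro i hi j hj hij
  refine (eq_of_xcoord_eq_zero_imp I hp hi ?_).symm
  filter_upwards [hσ' i hi, hσ' j hj] with q h1 h2 h3
  rw [h2, ← hij, ← h1, h3]

/-- The boundary codimension can be computed in any chart. -/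
lemma bdryCodim_eq {e : OpenPartialHomeomorph M H}
    (he : e ∈ IsManifold.maximalAtlas I ∞ M) {p : M} (hp : p ∈ e.source) :
    bdryCodim I p = {i : ι | xcoord I e i p = 0}.ncard :=
  le_antisymm
    (ncard_xcoord_eq_zero_le I (IsManifold.chart_mem_maximalAtlas p) he (mem_chart_source H p) hp)
    (ncard_xcoord_eq_zero_le I he (IsManifold.chart_mem_maximalAtlas p) hp (mem_chart_source H p))

end CoordinateChange

/-! ### Small neighbourhoods that are convex in coordinates. -/

section CoordinateNeighbourhoods

variable {E H M : Type*} [NormedAddCommGroup E] [NormedSpace ℝ E] [TopologicalSpace H]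
  [TopologicalSpace M] (I : ModelWithCorners ℝ E H) {ι : Type} [Fintype ι] [CornerModel I ι]

/-- Points have small coordinate neighbourhoods which meet every set that is convex in the coordinates
in a connected set. -/
lemma exists_convex_neighbourhood {e : OpenPartialHomeomorph M H} {p : M} (hp : p ∈ e.source)
    {N : Set M} (hN : N ∈ 𝓝 p) :
    ∃ U : Set M, IsOpen U ∧ p ∈ U ∧ U ⊆ N ∧ U ⊆ e.source ∧
      ∀ C : Set (ι → ℝ), Convex ℝ C → IsPreconnected {q ∈ U | cmap I e q ∈ C} := by
  have h1 : ∀ᶠ x in 𝓝[orthant ι] (cmap I e p),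
      (cmap I e (cinv I e x) = x ∧ cinv I e x ∈ e.source) ∧ cinv I e x ∈ N :=
    (eventually_cmap_cinv I hp).and ((tendsto_cinv I hp).eventually hN)
  obtain ⟨r, hr, hr'⟩ := Metric.eventually_nhds_iff.1 (eventually_nhdsWithin_iff.1 h1)
  refine ⟨e.source ∩ cmap I e ⁻¹' Metric.ball (cmap I e p) r, ?_, ?_, ?_, inter_subset_left, ?_⟩
  · exact ContinuousOn.isOpen_inter_preimage
      (fun q hq => (continuousAt_cmap I hq).continuousWithinAt) e.open_source Metric.isOpen_ball
  · exact ⟨hp, Metric.mem_ball_self hr⟩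
  · rintro q ⟨hq, hqr⟩
    have := (hr' hqr (cmap_mem_orthant I e q)).2
    rwa [cinv_cmap I hq] at this
  · intro C hC
    have h2 : {q ∈ e.source ∩ cmap I e ⁻¹' Metric.ball (cmap I e p) r | cmap I e q ∈ C} =
        cinv I e '' (Metric.ball (cmap I e p) r ∩ orthant ι ∩ C) := by
      ext q
      constructor
      · rintro ⟨⟨hq, hqr⟩, hqC⟩
        exact ⟨cmap I e q, ⟨⟨hqr, cmap_mem_orthant I e q⟩, hqC⟩, cinv_cmap I hq⟩
      · rintro ⟨x, ⟨⟨hxr, hx⟩, hxC⟩, rfl⟩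
        obtain ⟨⟨h3, h4⟩, -⟩ := hr' hxr hx
        refine ⟨⟨h4, ?_⟩, ?_⟩
        · rw [mem_preimage, h3]; exact hxr
        · rw [h3]; exact hxC
    rw [h2]
    refine ((((convex_ball _ _).inter (convex_orthant ι)).inter hC).isPreconnected).image _ ?_
    rintro x ⟨⟨hxr, hx⟩, -⟩
    obtain ⟨⟨h3, h4⟩, -⟩ := hr' hxr hx
    have := tendsto_cinv I h4
    rw [h3] at this
    exact ContinuousWithinAt.mono this (fun y hy => hy.1.2)

lemma eventually_xcoord_ne_zero {e : OpenPartialHomeomorph M H} {p : M} (hp : p ∈ e.source) :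
    ∀ᶠ q in 𝓝 p, ∀ i, xcoord I e i q = 0 → xcoord I e i p = 0 := by
  refine eventually_all.2 fun i => ?_
  by_cases h : xcoord I e i p = 0
  · exact Eventually.of_forall fun _ _ => h
  · filter_upwards [(continuousAt_xcoord I hp i).eventually_ne h] with q hq hq'
    exact absurd hq' hq

end CoordinateNeighbourhoods

/-- The points of the open face on which exactly the coordinates with index in `J` vanish. -/
def openFace {ι : Type*} (J : Set ι) : Set (ι → ℝ) := {x | ∀ i, (i ∈ J → x i = 0) ∧ (i ∉ J → 0 < x i)}

lemma convex_openFace {ι : Type*} (J : Set ι) :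
    Convex ℝ (openFace J) := by
  intro x hx y hy a b ha hb hab i
  refine ⟨fun hi => ?_, fun hi => ?_⟩
  · simp [(hx i).1 hi, (hy i).1 hi]
  · have hxi := (hx i).2 hi
    have hyi := (hy i).2 hi
    rcases ha.eq_or_lt with rfl | ha'
    · obtain rfl : b = 1 := by linarith
      simpa using hyi
    · exact add_pos_of_pos_of_nonneg (mul_pos ha' hxi) (mul_nonneg hb hyi.le)

/-! ### Boundary faces are coordinate faces locally. -/

section Faces

variable {E H M : Type*} [NormedAddCommGroup E] [NormedSpace ℝ E] [TopologicalSpace H]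
  [TopologicalSpace M] [ChartedSpace H M] {I : ModelWithCorners ℝ E H}
  {ι : Type} [Fintype ι] [CornerModel I ι] [IsManifold I ∞ M]

/-- The hypothesis supplies one chart; matching of boundary coordinates moves the conclusion to any
other. -/
lemma HasEmbeddedHypersurfaces.exists_coord (hM : HasEmbeddedHypersurfaces I M) {F : Set M}
    (hF : IsFaceOfCodim I 1 F) {p : M} (hp : p ∈ F) {e : OpenPartialHomeomorph M H}
    (he : e ∈ IsManifold.maximalAtlas I ∞ M) (hpe : p ∈ e.source) :
    ∃ j, xcoord I e j p = 0 ∧ ∀ᶠ q in 𝓝 p, q ∈ F ↔ xcoord I e j q = 0 := by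
  obtain ⟨e', he', hpe', i, hi⟩ := hM F hF p hp
  have hp0 : xcoord I e' i p = 0 := by
    have : p ∈ F ∩ e'.source := ⟨hp, hpe'⟩
    rw [hi] at this
    exact this.2
  obtain ⟨j, hj, hev⟩ := exists_xcoord_eq_zero_iff I he' he hpe' hpe hp0
  refine ⟨j, hj, ?_⟩
  filter_upwards [hev, e'.open_source.mem_nhds hpe'] with q hq hqs
  rw [← hq]
  have : q ∈ F ∩ e'.source ↔ q ∈ {q ∈ e'.source | xcoord I e' i q = 0} := by rw [hi]
  simpa [hqs] using this

/-- The coordinates which vanish at a point define boundary hypersurfaces. -/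
lemma HasEmbeddedHypersurfaces.exists_hypersurface (hM : HasEmbeddedHypersurfaces I M) {p : M}
    {e : OpenPartialHomeomorph M H} (he : e ∈ IsManifold.maximalAtlas I ∞ M) (hp : p ∈ e.source)
    {i : ι} (hi : xcoord I e i p = 0) :
    ∃ F : Set M, IsFaceOfCodim I 1 F ∧ ∀ᶠ q in 𝓝 p, q ∈ F ↔ xcoord I e i q = 0 := by
  obtain ⟨U, hUo, hpU, -, hUe, hU⟩ := exists_convex_neighbourhood I hp univ_mem
  set V : Set M := {q ∈ U | cmap I e q ∈ openFace {i}}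
  -- V is connected and of codimension 1, so it lies in a single component, whose closure is the
  -- hypersurface sought.
  have hVc : IsPreconnected V := hU _ (convex_openFace {i})
  have hVf : ∃ᶠ q in 𝓝 p, q ∈ V := by
    refine ((frequently_zeroSet_xcoord I hp (J := {i}) (by simpa using hi)).and_eventually
      (hUo.mem_nhds hpU)).mono ?_
    rintro q ⟨hq, hqU⟩
    exact ⟨hqU, fun l => ⟨fun hl => (hq l).2 hl,
      fun hl => lt_of_le_of_ne (xcoord_nonneg I e l q) fun h => hl ((hq l).1 h.symm)⟩⟩
  have hVz : ∀ q ∈ V, ∀ l, xcoord I e l q = 0 ↔ l = i := fun q hq l =>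
    ⟨fun h => by_contra fun hl => ((hq.2 l).2 hl).ne' h, fun h => (hq.2 l).1 h⟩
  have hV1 : V ⊆ {q : M | bdryCodim I q = 1} := by
    intro q hq
    have : {l : ι | xcoord I e l q = 0} = {i} := by
      ext l; exact hVz q hq l
    change bdryCodim I q = 1
    rw [bdryCodim_eq I he (hUe hq.1), this, ncard_singleton]
  obtain ⟨r, hr⟩ := hVf.exists
  set F := closure (connectedComponentIn {q : M | bdryCodim I q = 1} r)
  have hVF : V ⊆ F := (hVc.subset_connectedComponentIn hr hV1).trans subset_closure
  have hF : IsFaceOfCodim I 1 F := ⟨r, hV1 hr, rfl⟩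
  have hpF : p ∈ F := by
    have : p ∈ closure F := mem_closure_iff_frequently.2 (hVf.mono hVF)
    rwa [isClosed_closure.closure_eq] at this
  -- F is the zero set of a single x_j near p. As V ⊆ F and only x_i vanishes on V, this forces j =
  -- i.
  obtain ⟨j, hj, hev⟩ := hM.exists_coord hF hpF he hp
  obtain ⟨q, hqV, hq⟩ := (hVf.and_eventually hev).exists
  obtain rfl : j = i := (hVz q hqV j).1 (hq.1 (hVF hqV))
  exact ⟨F, hF, hev⟩

/-- A connected component of the set of points of codimension `k` is contained in every boundary
hypersurface that it meets. -/
lemma HasEmbeddedHypersurfaces.mem_of_mem_component (hM : HasEmbeddedHypersurfaces I M) {F : Set M}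
    (hF : IsFaceOfCodim I 1 F) {k : ℕ} {p q q' : M}
    (hq : q ∈ connectedComponentIn {q : M | bdryCodim I q = k} p)
    (hq' : q' ∈ connectedComponentIn {q : M | bdryCodim I q = k} p) (hqF : q ∈ F) : q' ∈ F := by
  have hFc : IsClosed F := by
    obtain ⟨r, -, rfl⟩ := hF
    exact isClosed_closure
  set S := connectedComponentIn {q : M | bdryCodim I q = k} p
  have hSk : S ⊆ {q : M | bdryCodim I q = k} := connectedComponentIn_subset _ _
  -- On the component S, membership in F is open as well as closed: u is open, contains S ∩ F, and
  -- meets S only in F.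
  set u : Set M := {q | ∀ᶠ q' in 𝓝 q, bdryCodim I q' = k → q' ∈ F}
  have hu : IsOpen u := isOpen_iff_mem_nhds.2 fun _ h => eventually_eventually_nhds.2 h
  have hFu : ∀ q ∈ S, q ∈ F → q ∈ u := by
    intro q hq hqF
    have hm := mem_chart_source H q
    have hc := IsManifold.chart_mem_maximalAtlas (I := I) (n := ∞) q
    obtain ⟨j, hj, hev⟩ := hM.exists_coord hF hqF hc hm
    change ∀ᶠ q' in 𝓝 q, bdryCodim I q' = k → q' ∈ F
    filter_upwards [hev, eventually_xcoord_ne_zero I hm,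
      (chartAt H q).open_source.mem_nhds hm] with q' h1 h2 h3 h4
    rw [h1]
    rw [bdryCodim_eq I hc h3] at h4
    have h5 : bdryCodim I q = k := hSk hq
    rw [bdryCodim_eq I hc hm] at h5
    -- Near q only coordinates vanishing at q can vanish; equal cardinality k then forces the two
    -- sets to coincide.
    have h6 : {i : ι | xcoord I (chartAt H q) i q' = 0} = {i | xcoord I (chartAt H q) i q = 0} :=
      eq_of_subset_of_ncard_le h2 (by rw [h4, h5]) (toFinite _)
    have : j ∈ {i : ι | xcoord I (chartAt H q) i q' = 0} := by rw [h6]; exact hj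
    exact this
  by_contra hcon
  obtain ⟨r, hrS, hru, hrF⟩ := isPreconnected_connectedComponentIn u Fᶜ hu hFc.isOpen_compl
    (fun x hx => (em (x ∈ F)).imp (hFu x hx) id) ⟨q, hq, hFu q hq hqF⟩ ⟨q', hq', hcon⟩
  exact hrF (Eventually.self_of_nhds hru (hSk hrS))

/-- Near each of its points, a boundary face of codimension `k` is the zero set of `k` coordinates. -/
lemma HasEmbeddedHypersurfaces.exists_face_coords (hM : HasEmbeddedHypersurfaces I M) {k : ℕ}
    {F : Set M} (hF : IsFaceOfCodim I k F) {p : M} (hp : p ∈ F) {e : OpenPartialHomeomorph M H}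
    (he : e ∈ IsManifold.maximalAtlas I ∞ M) (hpe : p ∈ e.source) :
    ∃ J : Set ι, J.ncard = k ∧ (∀ j ∈ J, xcoord I e j p = 0) ∧
      ∀ᶠ q in 𝓝 p, q ∈ F ↔ ∀ j ∈ J, xcoord I e j q = 0 := by
  obtain ⟨p₀, hp₀, rfl⟩ := hF
  set S := connectedComponentIn {q : M | bdryCodim I q = k} p₀ with hS
  have hSk : S ⊆ {q : M | bdryCodim I q = k} := connectedComponentIn_subset _ _
  have h := fun i (hi : xcoord I e i p = 0) => hM.exists_hypersurface he hpe hi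
  choose! G hG hG' using h
  have hN : ∀ᶠ q in 𝓝 p, ∀ i, xcoord I e i p = 0 → (q ∈ G i ↔ xcoord I e i q = 0) :=
    eventually_all.2 fun i => eventually_imp_distrib_left.2 (hG' i)
  obtain ⟨U, hUo, hpU, hUN, hUe, hU⟩ := exists_convex_neighbourhood I hpe
    (hN.and (eventually_xcoord_ne_zero I hpe))
  -- A point of the open face near p; the coordinates vanishing at it form J.
  obtain ⟨q₀, hq₀U, hq₀S⟩ := mem_closure_iff.1 hp U hUo hpU
  set J : Set ι := {i | xcoord I e i q₀ = 0} with hJ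
  have hJk : J.ncard = k := by
    rw [← bdryCodim_eq I he (hUe hq₀U)]
    exact hSk hq₀S
  have hJp : ∀ j ∈ J, xcoord I e j p = 0 := fun j hj => (hUN hq₀U).2 j hj
  refine ⟨J, hJk, hJp, ?_⟩
  filter_upwards [hUo.mem_nhds hpU] with q hqU
  constructor
  · intro hq j hj
    -- The hypersurface of x_j contains q₀, hence the whole component S, so x_j vanishes on S near p
    -- and in the limit at q.
    have hfr : ∃ᶠ q' in 𝓝 q, xcoord I e j q' = 0 := by
      refine ((mem_closure_iff_frequently.1 hq).and_eventually (hUo.mem_nhds hqU)).mono ?_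
      rintro q' ⟨hq'S, hq'U⟩
      exact ((hUN hq'U).1 j (hJp j hj)).1 (hM.mem_of_mem_component (hG j (hJp j hj)) hq₀S hq'S
        (((hUN hq₀U).1 j (hJp j hj)).2 hj))
    by_contra hne
    exact hfr ((continuousAt_xcoord I (hUe hqU) j).eventually_ne hne)
  · intro hq
    -- Conversely, the open coordinate face V is connected, of codimension k and contains q₀, so V ⊆
    -- S; and V accumulates at q.
    set V : Set M := {q ∈ U | cmap I e q ∈ openFace J}
    have hVc : IsPreconnected V := hU _ (convex_openFace J)
    have hmemV : ∀ q ∈ U, (∀ l, xcoord I e l q = 0 ↔ l ∈ J) → q ∈ V := fun q hqU hq =>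
      ⟨hqU, fun l => ⟨fun hl => (hq l).2 hl,
        fun hl => lt_of_le_of_ne (xcoord_nonneg I e l q) fun h => hl ((hq l).1 h.symm)⟩⟩
    have hVk : V ⊆ {q : M | bdryCodim I q = k} := by
      intro q hq
      have : {l : ι | xcoord I e l q = 0} = J := by
        ext l
        exact ⟨fun h => by_contra fun hl => ((hq.2 l).2 hl).ne' h, fun h => (hq.2 l).1 h⟩
      change bdryCodim I q = k
      rw [bdryCodim_eq I he (hUe hq.1), this, hJk]
    have hVS : V ⊆ S := by
      rw [hS, connectedComponentIn_eq hq₀S]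
      exact hVc.subset_connectedComponentIn (hmemV q₀ hq₀U fun l => Iff.rfl) hVk
    refine mem_closure_iff_frequently.2 ?_
    refine ((frequently_zeroSet_xcoord I (hUe hqU) hq).and_eventually (hUo.mem_nhds hqU)).mono ?_
    rintro q' ⟨h1, h2⟩
    exact hVS (hmemV q' h2 h1)

lemma HasEmbeddedHypersurfaces.le_bdryCodim (hM : HasEmbeddedHypersurfaces I M) {k : ℕ}
    {F : Set M} (hF : IsFaceOfCodim I k F) {p : M} (hp : p ∈ F) : k ≤ bdryCodim I p := by
  obtain ⟨J, rfl, hJ, -⟩ := hM.exists_face_coords hF hp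
    (IsManifold.chart_mem_maximalAtlas p) (mem_chart_source H p)
  exact ncard_le_ncard hJ (toFinite _)

end Faces

/-! ### Independent rows, right inverses and perturbed linear equations. -/

section LinearAlgebra

variable {ι κ : Type*} [Fintype ι] [Fintype κ]

/-- A matrix whose multiplication map is onto has linearly independent rows. -/
lemma linearIndependent_of_mulVec_surjective {m : κ → ι → ℝ}
    (h : Function.Surjective fun (v : ι → ℝ) (k : κ) => ∑ i, m k i * v i) :
    LinearIndependent ℝ m := by
  rw [Fintype.linearIndependent_iff]
  intro c hc
  -- With m v = c and c m = 0, the square of the length of c is c m v = 0.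
  obtain ⟨v, hv⟩ := h c
  have h0 : ∑ k, c k * c k = 0 := by
    calc ∑ k, c k * c k = ∑ k, c k * ∑ i, m k i * v i := by
          refine Finset.sum_congr rfl fun k _ => ?_
          rw [← congrFun hv k]
      _ = ∑ i, (∑ k, c k • m k) i * v i := by
          simp only [Finset.mul_sum, Finset.sum_apply, Finset.sum_mul, Pi.smul_apply, smul_eq_mul]
          rw [Finset.sum_comm]
          exact Finset.sum_congr rfl fun i _ => Finset.sum_congr rfl fun k _ => by ring
      _ = 0 := by rw [hc]; simp
  intro k
  have := (Finset.sum_eq_zero_iff_of_nonneg fun k _ => mul_self_nonneg (c k)).1 h0 k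
    (Finset.mem_univ k)
  exact mul_self_eq_zero.1 this

/-- A matrix with linearly independent rows has a right inverse. -/
lemma exists_rightInverse_of_linearIndependent {m : κ → ι → ℝ} (h : LinearIndependent ℝ m) :
    ∃ R : (κ → ℝ) →L[ℝ] (ι → ℝ), ∀ w k, ∑ i, m k i * R w i = w k := by
  classical
  have hr := LinearIndependent.rank_matrix (M := Matrix.of m) h
  have hs : LinearMap.range (Matrix.of m).mulVecLin = ⊤ := by
    apply Submodule.eq_top_of_finrank_eq
    rw [Module.finrank_fintype_fun_eq_card]
    exact hr
  obtain ⟨g, hg⟩ := LinearMap.exists_rightInverse_of_surjective _ hs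
  refine ⟨LinearMap.toContinuousLinearMap g, fun w k => ?_⟩
  exact congrFun (LinearMap.congr_fun hg w) k

end LinearAlgebra

/-- The solutions of a small Lipschitz perturbation of a linear equation, cut out by a convex set in
straightened coordinates, form a connected set. -/
lemma isPreconnected_perturbed_solutions {E F : Type*} [NormedAddCommGroup E] [NormedSpace ℝ E]
    [CompleteSpace E] [NormedAddCommGroup F] [NormedSpace ℝ F] (B : E →ₗ[ℝ] F) (R : F →L[ℝ] E)
    (hBR : ∀ w, B (R w) = w) {h : E → F} {c : NNReal} (hh : LipschitzWith c h)
    (hc : ‖R‖₊ * c < 1) {C : Set E} (hC : Convex ℝ C) (b : F) :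
    IsPreconnected {t | t + R (h t) ∈ C ∧ B t + h t = b} := by
  -- The map t ↦ t + R (h t) is a homeomorphism, being a perturbation of the identity by a Lipschitz
  -- map with constant below 1. Since B (t + R (h t)) = B t + h t, it carries the solutions onto a
  -- convex set.
  have hl : LipschitzWith (‖R‖₊ * c) fun t => R (h t) := R.lipschitz.comp hh
  have ha : ApproximatesLinearOn (fun t => t + R (h t))
      (ContinuousLinearEquiv.refl ℝ E : E →L[ℝ] E) univ (‖R‖₊ * c) := by
    intro x _ y _
    have := hl.dist_le_mul x y
    rw [dist_eq_norm, dist_eq_norm] at this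
    refine le_trans (le_of_eq ?_) this
    congr 1
    simp only [ContinuousLinearEquiv.coe_refl, ContinuousLinearMap.id_apply]
    abel
  have hn : Subsingleton E ∨ ‖R‖₊ * c <
      ‖((ContinuousLinearEquiv.refl ℝ E).symm : E →L[ℝ] E)‖₊⁻¹ := by
    rcases subsingleton_or_nontrivial E with hE | hE
    · exact Or.inl hE
    · right
      have : ‖((ContinuousLinearEquiv.refl ℝ E).symm : E →L[ℝ] E)‖₊ = 1 := by
        rw [ContinuousLinearEquiv.refl_symm, ContinuousLinearEquiv.coe_refl]
        exact ContinuousLinearMap.nnnorm_id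
      rw [this, inv_one]
      exact hc
  let Φ := ha.toHomeomorph _ hn
  have hΦ : ∀ t, Φ t = t + R (h t) := fun t => rfl
  have hconv : Convex ℝ (C ∩ {s | B s = b}) := by
    refine hC.inter ?_
    have : {s | B s = b} = B ⁻¹' {b} := rfl
    rw [this]
    exact (convex_singleton b).linear_preimage B
  have heq : {t | t + R (h t) ∈ C ∧ B t + h t = b} = Φ.symm '' (C ∩ {s | B s = b}) := by
    rw [Homeomorph.image_symm]
    ext t
    simp [hΦ, hBR]
  rw [heq]
  exact hconv.isPreconnected.image _ Φ.symm.continuous.continuousOn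

/-! ### Logarithmic coordinates on open faces. -/

section LogCoordinates

variable {ι : Type*}

open scoped Classical in
/-- Logarithmic coordinates on the open face of the orthant on which exactly the coordinates with
index in `J` vanish. -/
noncomputable def expFace (J : Set ι) (t : ι → ℝ) : ι → ℝ := fun i =>
  if i ∈ J then 0 else Real.exp (t i)

lemma expFace_of_mem {J : Set ι} {i : ι} (hi : i ∈ J) (t : ι → ℝ) : expFace J t i = 0 := by
  simp [expFace, hi]

lemma expFace_of_notMem {J : Set ι} {i : ι} (hi : i ∉ J) (t : ι → ℝ) :
    expFace J t i = Real.exp (t i) := by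
  simp [expFace, hi]

lemma expFace_mem_orthant (J : Set ι) (t : ι → ℝ) : expFace J t ∈ orthant ι := by
  intro i
  by_cases hi : i ∈ J
  · rw [expFace_of_mem hi]
  · rw [expFace_of_notMem hi]; positivity

lemma continuous_expFace (J : Set ι) : Continuous (expFace J) := by
  refine continuous_pi fun i => ?_
  by_cases hi : i ∈ J
  · simp only [expFace_of_mem hi]; fun_prop
  · simp only [expFace_of_notMem hi]; fun_prop

/-- In logarithmic coordinates ∂/∂t_i becomes x_i ∂/∂x_i, so the chain rule yields b-derivatives. -/
lemma hasFDerivAt_expFace [Fintype ι] (J : Set ι) (t : ι → ℝ) :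
    HasFDerivAt (expFace J) (ContinuousLinearMap.mul ℝ (ι → ℝ) (expFace J t)) t := by
  rw [hasFDerivAt_pi']
  intro i
  by_cases hi : i ∈ J
  · have h : (fun s => expFace J s i) = fun _ => 0 := funext fun s => expFace_of_mem hi s
    rw [h]
    refine (hasFDerivAt_const (0 : ℝ) t).congr_fderiv ?_
    ext v
    simp [expFace_of_mem hi]
  · have h : (fun s => expFace J s i) = fun s => Real.exp (s i) :=
      funext fun s => expFace_of_notMem hi s
    rw [h]
    refine ((hasFDerivAt_apply (𝕜 := ℝ) i t).exp).congr_fderiv ?_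
    ext v
    simp [expFace_of_notMem hi]

/-- The set of logarithmic coordinates of points near `x₀`: coordinates at most `-T` where `x₀`
vanishes, and within `δ` of those of `x₀` elsewhere. -/
def logBox (x₀ : ι → ℝ) (δ T : ℝ) : Set (ι → ℝ) :=
  {t | ∀ i, (x₀ i = 0 → t i ≤ -T) ∧ (x₀ i ≠ 0 → |t i - Real.log (x₀ i)| ≤ δ)}

lemma logBox_mono (x₀ : ι → ℝ) {δ δ' T T' : ℝ} (hδ : δ ≤ δ') (hT : T' ≤ T) :
    logBox x₀ δ T ⊆ logBox x₀ δ' T' := fun _ ht i =>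
  ⟨fun hi => ((ht i).1 hi).trans (neg_le_neg hT), fun hi => ((ht i).2 hi).trans hδ⟩

lemma convex_logBox (x₀ : ι → ℝ) (δ T : ℝ) : Convex ℝ (logBox x₀ δ T) := by
  have h : logBox x₀ δ T = Set.pi univ fun i =>
      {s : ℝ | (x₀ i = 0 → s ∈ Iic (-T)) ∧ (x₀ i ≠ 0 → s ∈ Metric.closedBall (Real.log (x₀ i)) δ)} := by
    ext t
    simp [logBox, Set.mem_pi, Real.dist_eq]
  rw [h]
  refine convex_pi fun i _ => ?_
  by_cases hi : x₀ i = 0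
  · have h : {s : ℝ | (x₀ i = 0 → s ∈ Iic (-T)) ∧
        (x₀ i ≠ 0 → s ∈ Metric.closedBall (Real.log (x₀ i)) δ)} = Iic (-T) := by
      ext s; simp [hi]
    rw [h]
    exact convex_Iic _
  · have h : {s : ℝ | (x₀ i = 0 → s ∈ Iic (-T)) ∧
        (x₀ i ≠ 0 → s ∈ Metric.closedBall (Real.log (x₀ i)) δ)} =
        Metric.closedBall (Real.log (x₀ i)) δ := by
      ext s; simp [hi]
    rw [h]
    exact convex_closedBall _ _

/-- A single small parameter s > 0 provides both δ = s and T = s⁻¹; letting s → 0 sends the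
vanishing coordinates to 0 through t = -∞. -/
lemma exists_logBox [Fintype ι] {x₀ : ι → ℝ} (hx₀ : x₀ ∈ orthant ι) {J : Set ι} (hJ : ∀ j ∈ J, x₀ j = 0)
    {N : Set (ι → ℝ)} (hN : N ∈ 𝓝[orthant ι] x₀) :
    ∃ δ > 0, ∃ T, ∀ t ∈ logBox x₀ δ T, expFace J t ∈ N := by
  obtain ⟨r, hr, hrN⟩ := Metric.mem_nhdsWithin_iff.1 hN
  have h : ∀ i, ∀ᶠ s : ℝ in 𝓝[>] 0, ∀ t : ℝ, ((x₀ i = 0 → t ≤ -s⁻¹) ∧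
      (x₀ i ≠ 0 → |t - Real.log (x₀ i)| ≤ s)) → |Real.exp t - x₀ i| < r := by
    intro i
    by_cases hi : x₀ i = 0
    · have h1 : Tendsto (fun s : ℝ => Real.exp (-s⁻¹)) (𝓝[>] 0) (𝓝 0) :=
        Real.tendsto_exp_atBot.comp (tendsto_neg_atTop_atBot.comp tendsto_inv_nhdsGT_zero)
      filter_upwards [h1.eventually (gt_mem_nhds hr)] with s hs t ht
      rw [hi, sub_zero, abs_of_pos (Real.exp_pos _)]
      exact (Real.exp_le_exp.2 (ht.1 hi)).trans_lt hs
    · have hpos : 0 < x₀ i := lt_of_le_of_ne (hx₀ i) (Ne.symm hi)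
      have h1 := Real.continuous_exp.tendsto (Real.log (x₀ i))
      rw [Real.exp_log hpos] at h1
      obtain ⟨ε, hε, h2⟩ := Metric.tendsto_nhds_nhds.1 h1 r hr
      filter_upwards [nhdsWithin_le_nhds (gt_mem_nhds hε)] with s hs t ht
      exact h2 ((ht.2 hi).trans_lt hs)
  obtain ⟨s, hs, hs0⟩ := ((eventually_all.2 h).and self_mem_nhdsWithin).exists
  refine ⟨s, hs0, s⁻¹, fun t ht => hrN ⟨?_, expFace_mem_orthant J t⟩⟩
  rw [Metric.mem_ball, dist_pi_lt_iff hr]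
  intro i
  by_cases hi : i ∈ J
  · rw [expFace_of_mem hi, hJ i hi, dist_self]; exact hr
  · rw [expFace_of_notMem hi]; exact hs i (t i) (ht i)

open scoped Classical in
/-- The nearest point retraction onto `logBox`. -/
noncomputable def logClamp (x₀ : ι → ℝ) (δ T : ℝ) (t : ι → ℝ) : ι → ℝ := fun i =>
  if x₀ i = 0 then min (t i) (-T) else max (min (t i) (Real.log (x₀ i) + δ)) (Real.log (x₀ i) - δ)

lemma logClamp_mem (x₀ : ι → ℝ) {δ : ℝ} (hδ : 0 ≤ δ) (T : ℝ) (t : ι → ℝ) :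
    logClamp x₀ δ T t ∈ logBox x₀ δ T := by
  intro i
  refine ⟨fun hi => ?_, fun hi => ?_⟩
  · simp [logClamp, hi]
  · simp only [logClamp, hi, if_false]
    rw [abs_le]
    constructor
    · have := le_max_right (min (t i) (Real.log (x₀ i) + δ)) (Real.log (x₀ i) - δ)
      linarith
    · have : max (min (t i) (Real.log (x₀ i) + δ)) (Real.log (x₀ i) - δ) ≤ Real.log (x₀ i) + δ :=
        max_le (min_le_right _ _) (by linarith)
      linarith

lemma logClamp_of_mem {x₀ : ι → ℝ} {δ T : ℝ} {t : ι → ℝ} (ht : t ∈ logBox x₀ δ T) :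
    logClamp x₀ δ T t = t := by
  funext i
  by_cases hi : x₀ i = 0
  · simp [logClamp, hi, (ht i).1 hi]
  · have := abs_le.1 ((ht i).2 hi)
    simp only [logClamp, hi, if_false]
    rw [min_eq_left (by linarith), max_eq_left (by linarith)]

/-- Composition with the retraction extends a Lipschitz function from the box to the whole space
without increasing its constant. -/
lemma lipschitzWith_logClamp [Fintype ι] (x₀ : ι → ℝ) (δ T : ℝ) : LipschitzWith 1 (logClamp x₀ δ T) := by
  refine LipschitzWith.of_dist_le_mul fun s t => ?_
  rw [NNReal.coe_one, one_mul, dist_pi_le_iff dist_nonneg]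
  intro i
  refine le_trans ?_ (dist_le_pi_dist s t i)
  rw [Real.dist_eq, Real.dist_eq]
  have key : ∀ a : ℝ, |min (s i) a - min (t i) a| ≤ |s i - t i| := fun a => by
    simpa using abs_min_sub_min_le_max (s i) a (t i) a
  by_cases hi : x₀ i = 0
  · simpa only [logClamp, hi, if_true] using key _
  · simp only [logClamp, hi, if_false]
    refine le_trans ?_ (key (Real.log (x₀ i) + δ))
    simpa using abs_max_sub_max_le_max (min (s i) (Real.log (x₀ i) + δ)) (Real.log (x₀ i) - δ)
      (min (t i) (Real.log (x₀ i) + δ)) (Real.log (x₀ i) - δ)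

end LogCoordinates

/-! ### Local connectedness of binomial solution sets. -/

section OpenFace

variable {ι : Type*}

lemma expFace_mem_openFace (J : Set ι) (t : ι → ℝ) : expFace J t ∈ openFace J := fun i =>
  ⟨fun hi => expFace_of_mem hi t, fun hi => by rw [expFace_of_notMem hi]; positivity⟩

/-- Local connectedness at `x₀` of the set of solutions of the logarithmic equations
`∑ i, B k i * log (x i) + ψ k x = 0`, provided that the logarithmic differential of `ψ` vanishes
at `x₀` and `B` has independent rows. -/
lemma exists_preconnected_log_solutions {κ : Type*} [Fintype ι] [Fintype κ] {x₀ : ι → ℝ}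
    (hx₀ : x₀ ∈ orthant ι) {J : Set ι}
    (hJ : ∀ j ∈ J, x₀ j = 0) {B : κ → ι → ℝ} (hB : LinearIndependent ℝ B)
    (hBJ : ∀ k, ∀ j ∈ J, B k j = 0) {ψ : (ι → ℝ) → κ → ℝ}
    (hψ : ContDiffWithinAt ℝ ∞ ψ (orthant ι) x₀)
    (hψ0 : (fderivWithin ℝ ψ (orthant ι) x₀).comp (ContinuousLinearMap.mul ℝ (ι → ℝ) x₀) = 0)
    {N : Set (ι → ℝ)} (hN : N ∈ 𝓝[orthant ι] x₀) :
    ∃ N' ∈ 𝓝[orthant ι] x₀, ∃ K, IsPreconnected K ∧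
      (∀ x ∈ openFace J, x ∈ N' → (∀ k, ∑ i, B k i * Real.log (x i) + ψ x k = 0) → x ∈ K) ∧
      ∀ x ∈ K, x ∈ openFace J ∧ x ∈ N ∧ ∀ k, ∑ i, B k i * Real.log (x i) + ψ x k = 0 := by
  classical
  obtain ⟨R, hR⟩ := exists_rightInverse_of_linearIndependent hB
  -- The bound 1/4 makes the perturbation contracting and, as |h| ≤ 2cδ below, gives |R h| ≤ δ/2.
  obtain ⟨c, hc0, hRc⟩ : ∃ c : NNReal, 0 < c ∧ ‖R‖₊ * c ≤ 1 / 4 := by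
    refine ⟨1 / (4 * (‖R‖₊ + 1)), by positivity, ?_⟩
    rw [mul_one_div, div_le_div_iff₀ (by positivity) (by norm_num)]
    nlinarith [zero_le (a := ‖R‖₊)]
  have hRc' : ‖R‖ * c ≤ 1 / 4 := by exact_mod_cast hRc
  -- The derivative of `ψ` in logarithmic coordinates is small near `x₀`.
  set Q : (ι → ℝ) → (ι → ℝ) →L[ℝ] (κ → ℝ) := fun x =>
    (fderivWithin ℝ ψ (orthant ι) x).comp (ContinuousLinearMap.mul ℝ (ι → ℝ) x) with hQ
  have hQc : ContinuousWithinAt Q (orthant ι) x₀ := by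
    have h1 := (hψ.fderivWithin_right (m := 0) (uniqueDiffOn_orthant ι) (by simp)
      hx₀).continuousWithinAt
    exact h1.clm_comp (ContinuousLinearMap.mul ℝ (ι → ℝ)).continuous.continuousWithinAt
  have hQ0 : ∀ᶠ x in 𝓝[orthant ι] x₀, ‖Q x‖₊ ≤ c := by
    have h1 : Tendsto (fun x => ‖Q x‖₊) (𝓝[orthant ι] x₀) (𝓝 ‖Q x₀‖₊) := hQc.nnnorm
    have h2 : Q x₀ = 0 := hψ0
    rw [h2, nnnorm_zero] at h1
    exact h1.eventually (ge_mem_nhds hc0)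
  have hdiff : ∀ᶠ x in 𝓝[orthant ι] x₀, DifferentiableWithinAt ℝ ψ (orthant ι) x := by
    have h1 : ContDiffWithinAt ℝ 1 ψ (orthant ι) x₀ := hψ.of_le (by simp)
    have := h1.eventually (by simp)
    rw [insert_eq_of_mem hx₀] at this
    filter_upwards [this] with x hx using hx.differentiableWithinAt (by simp)
  obtain ⟨δ, hδ, T₀, hT₀⟩ := exists_logBox hx₀ hJ ((hQ0.and hdiff).and hN)
  have hψc := hψ.continuousWithinAt
  obtain ⟨δ₂, hδ₂, T₂, hT₂⟩ := exists_logBox hx₀ hJ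
    (hψc.eventually (Metric.closedBall_mem_nhds (ψ x₀) (show 0 < c * δ by positivity)))
  set T := max T₀ T₂ with hT
  set W := logBox x₀ δ T with hW
  have hWT₀ : ∀ t ∈ W, ((‖Q (expFace J t)‖₊ ≤ c ∧
      DifferentiableWithinAt ℝ ψ (orthant ι) (expFace J t)) ∧ expFace J t ∈ N) := fun t ht =>
    hT₀ t (logBox_mono x₀ le_rfl (le_max_left _ _) ht)
  have hlipW : LipschitzOnWith c (fun t => ψ (expFace J t)) W := by
    refine (convex_logBox x₀ δ T).lipschitzOnWith_of_nnnorm_hasFDerivWithin_le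
      (f' := fun t => Q (expFace J t)) (fun t ht => ?_) fun t ht => (hWT₀ t ht).1.1
    have h1 := (hWT₀ t ht).1.2.hasFDerivWithinAt
    exact (h1.comp_hasFDerivAt t (hasFDerivAt_expFace J t)
      (Eventually.of_forall fun s => expFace_mem_orthant J s)).hasFDerivWithinAt
  set h : (ι → ℝ) → κ → ℝ := fun t => ψ (expFace J (logClamp x₀ δ T t)) - ψ x₀ with hh
  have hlip : LipschitzWith c h := by
    refine LipschitzWith.of_dist_le_mul fun s t => ?_
    rw [hh, dist_sub_right]
    refine (hlipW.dist_le_mul _ (logClamp_mem x₀ hδ.le T s) _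
      (logClamp_mem x₀ hδ.le T t)).trans ?_
    have := (lipschitzWith_logClamp x₀ δ T).dist_le_mul s t
    rw [NNReal.coe_one, one_mul] at this
    exact mul_le_mul_of_nonneg_left this c.coe_nonneg
  have hbound : ∀ t, ‖R (h t)‖ ≤ δ / 2 := by
    intro t
    set w := logClamp x₀ δ T t with hw
    have hwW : w ∈ W := logClamp_mem x₀ hδ.le T t
    -- The box is unbounded, so the Lipschitz bound alone does not control h. Moving from w to w'
    -- changes only coordinates with x₀ i ≠ 0, by at most δ; since w' agrees there with log x₀, it
    -- also lies in the second box, where continuity of ψ applies.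
    set w' : ι → ℝ := fun i => if x₀ i = 0 then w i else Real.log (x₀ i) with hw'
    have hw'0 : ∀ ε ≥ 0, w' ∈ logBox x₀ ε T := fun ε hε i =>
      ⟨fun hi => by simpa [hw', hi] using (hwW i).1 hi, fun hi => by simpa [hw', hi] using hε⟩
    have h1 : dist w w' ≤ δ := by
      rw [dist_pi_le_iff hδ.le]
      intro i
      by_cases hi : x₀ i = 0
      · simp [hw', hi, hδ.le]
      · simpa [hw', hi, Real.dist_eq] using (hwW i).2 hi
    have h2 : dist (ψ (expFace J w)) (ψ (expFace J w')) ≤ c * δ :=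
      (hlipW.dist_le_mul _ hwW _ (hw'0 δ hδ.le)).trans
        (mul_le_mul_of_nonneg_left h1 c.coe_nonneg)
    have h3 : dist (ψ (expFace J w')) (ψ x₀) ≤ c * δ :=
      hT₂ w' (logBox_mono x₀ le_rfl (le_max_right _ _) (hw'0 δ₂ hδ₂.le))
    have h4 : ‖h t‖ ≤ c * δ + c * δ := by
      rw [hh, ← dist_eq_norm]
      exact (dist_triangle _ _ _).trans (add_le_add h2 h3)
    calc ‖R (h t)‖ ≤ ‖R‖ * ‖h t‖ := R.le_opNorm _
      _ ≤ ‖R‖ * (c * δ + c * δ) := by gcongr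
      _ = (‖R‖ * c) * (2 * δ) := by ring
      _ ≤ 1 / 4 * (2 * δ) := by gcongr
      _ = δ / 2 := by ring
  -- The box in straightened coordinates.
  set C : Set (ι → ℝ) := {s | ∀ i, (x₀ i = 0 → s i < -T - δ / 2) ∧
    (x₀ i ≠ 0 → |s i - Real.log (x₀ i)| < δ / 2)} with hC
  have hCc : Convex ℝ C := by
    have h1 : C = Set.pi univ fun i => if x₀ i = 0 then Iio (-T - δ / 2) else
        Metric.ball (Real.log (x₀ i)) (δ / 2) := by
      ext t
      simp only [hC, mem_ofPred_eq, Set.mem_pi, mem_univ, forall_const]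
      refine forall_congr' fun i => ?_
      by_cases hi : x₀ i = 0 <;> simp [hi, Real.dist_eq]
    rw [h1]
    refine convex_pi fun i _ => ?_
    by_cases hi : x₀ i = 0
    · simp only [hi, if_true]; exact convex_Iio _
    · simp only [hi, if_false]; exact convex_ball _ _
  let Bl : (ι → ℝ) →ₗ[ℝ] (κ → ℝ) := (Matrix.of B).mulVecLin
  have hBl : ∀ t k, Bl t k = ∑ i, B k i * t i := fun t k => rfl
  have hBlog : ∀ t k, ∑ i, B k i * Real.log (expFace J t i) = Bl t k := fun t k => by
    rw [hBl]
    refine Finset.sum_congr rfl fun i _ => ?_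
    by_cases hi : i ∈ J
    · simp [hBJ k i hi]
    · rw [expFace_of_notMem hi, Real.log_exp]
  have hKpre := isPreconnected_perturbed_solutions Bl R
    (fun w => funext fun k => hR w k) hlip (lt_of_le_of_lt hRc (by norm_num)) hCc (-ψ x₀)
  set K₀ : Set (ι → ℝ) := {t | t + R (h t) ∈ C ∧ Bl t + h t = -ψ x₀} with hK₀
  have hmemW : ∀ t ∈ W, h t = ψ (expFace J t) - ψ x₀ := fun t ht => by
    rw [hh]
    simp only [logClamp_of_mem ht]
  have heqn : ∀ t ∈ W, Bl t + h t = -ψ x₀ ↔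
      ∀ k, ∑ i, B k i * Real.log (expFace J t i) + ψ (expFace J t) k = 0 := by
    intro t ht
    rw [hmemW t ht, funext_iff]
    refine forall_congr' fun k => ?_
    rw [hBlog]
    simp only [Pi.add_apply, Pi.sub_apply, Pi.neg_apply]
    constructor <;> intro h5 <;> linarith
  -- These margins put t in W, and the perturbation, smaller than δ/4, then leaves t + R (h t) in C.
  have hN' : ∀ᶠ x in 𝓝[orthant ι] x₀, ‖R (ψ x - ψ x₀)‖ < δ / 4 ∧
      ∀ i, (x₀ i = 0 → x i < Real.exp (-T - δ)) ∧
        (x₀ i ≠ 0 → |Real.log (x i) - Real.log (x₀ i)| < δ / 4) := by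
    refine Eventually.and ?_ (eventually_all.2 fun i => ?_)
    · have h1 : ContinuousWithinAt (fun x => ‖R (ψ x - ψ x₀)‖) (orthant ι) x₀ :=
        (R.continuous.continuousAt.comp_continuousWithinAt
          (hψc.sub continuousWithinAt_const)).norm
      have h2 := h1.tendsto
      simp only [sub_self, map_zero, norm_zero] at h2
      exact h2.eventually (gt_mem_nhds (by positivity))
    · refine nhdsWithin_le_nhds ?_
      have h1 : Tendsto (fun x : ι → ℝ => x i) (𝓝 x₀) (𝓝 (x₀ i)) :=
        (continuous_apply i).tendsto x₀
      by_cases hi : x₀ i = 0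
      · rw [hi] at h1
        filter_upwards [h1.eventually (gt_mem_nhds (Real.exp_pos (-T - δ)))] with x hx
        exact ⟨fun _ => hx, fun h => absurd hi h⟩
      · have h2 := h1.log hi
        filter_upwards [h2.eventually (Metric.ball_mem_nhds _ (show 0 < δ / 4 by positivity))]
          with x hx
        exact ⟨fun h => absurd h hi, fun _ => hx⟩
  refine ⟨_, hN', expFace J '' K₀, hKpre.image _ (continuous_expFace J).continuousOn, ?_, ?_⟩
  · rintro x hxJ ⟨hxR, hx⟩ hxs
    -- `expFace J` ignores the entries in J; any value below -T - δ serves.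
    set t : ι → ℝ := fun i => if i ∈ J then -T - δ - 1 else Real.log (x i) with ht
    have htx : expFace J t = x := by
      funext i
      by_cases hi : i ∈ J
      · rw [expFace_of_mem hi, (hxJ i).1 hi]
      · rw [expFace_of_notMem hi]
        simp only [ht, hi, if_false]
        exact Real.exp_log ((hxJ i).2 hi)
    have ht1 : ∀ i, x₀ i = 0 → t i < -T - δ := by
      intro i hi
      by_cases hiJ : i ∈ J
      · simp [ht, hiJ]
      · simp only [ht, hiJ, if_false]
        rw [Real.log_lt_iff_lt_exp ((hxJ i).2 hiJ)]
        exact (hx i).1 hi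
    have ht2 : ∀ i, x₀ i ≠ 0 → |t i - Real.log (x₀ i)| < δ / 4 := by
      intro i hi
      have hiJ : i ∉ J := fun h => hi (hJ i h)
      simp only [ht, hiJ, if_false]
      exact (hx i).2 hi
    have htW : t ∈ W := fun i => ⟨fun hi => by linarith [ht1 i hi],
      fun hi => by linarith [ht2 i hi]⟩
    have hRi : ∀ i, |R (h t) i| < δ / 4 := fun i => by
      rw [hmemW t htW, htx, ← Real.norm_eq_abs]
      exact (norm_le_pi_norm _ i).trans_lt hxR
    refine ⟨t, ⟨fun i => ⟨fun hi => ?_, fun hi => ?_⟩, ?_⟩, htx⟩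
    · have h1 := abs_lt.1 (hRi i)
      have h2 := ht1 i hi
      simp only [Pi.add_apply]
      linarith
    · have h1 := abs_lt.1 (hRi i)
      have h2 := abs_lt.1 (ht2 i hi)
      simp only [Pi.add_apply]
      rw [abs_lt]
      constructor <;> linarith
    · rw [heqn t htW, htx]
      exact hxs
  · rintro _ ⟨t, ⟨htC, hteq⟩, rfl⟩
    have hRi : ∀ i, |R (h t) i| ≤ δ / 2 := fun i =>
      (norm_le_pi_norm (R (h t)) i).trans (hbound t)
    -- C is W shrunk by δ/2, which is the bound on R (h t), so the clamp is inactive at t.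
    have htW : t ∈ W := by
      intro i
      have h1 := abs_le.1 (hRi i)
      have h2 := htC i
      simp only [Pi.add_apply] at h2
      refine ⟨fun hi => ?_, fun hi => ?_⟩
      · have := h2.1 hi
        linarith
      · have := abs_lt.1 (h2.2 hi)
        rw [abs_le]
        constructor <;> linarith
    exact ⟨expFace_mem_openFace J t, (hWT₀ t htW).2, (heqn t htW).1 hteq⟩

end OpenFace

/-- Coordinates that vanish have exponent 0: they contribute the factor 0 ^ 0 = 1 and the summand 0,
so logarithms may be taken. -/
lemma binomial_eq_one_iff {ι : Type*} [Fintype ι] {J : Set ι} {x : ι → ℝ} (hx : x ∈ openFace J)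
    {γ : ι → ℤ} (hγ : ∀ j ∈ J, γ j = 0) {A : ℝ} (hA : 0 < A) :
    A * ∏ i, x i ^ γ i = 1 ↔ Real.log A + ∑ i, (γ i : ℝ) * Real.log (x i) = 0 := by
  have hpos : ∀ i, 0 < x i ^ γ i := fun i => by
    by_cases hi : i ∈ J
    · simp [hγ i hi]
    · exact zpow_pos ((hx i).2 hi) _
  have hP : 0 < ∏ i, x i ^ γ i := Finset.prod_pos fun i _ => hpos i
  have hlog : Real.log (A * ∏ i, x i ^ γ i) =
      Real.log A + ∑ i, (γ i : ℝ) * Real.log (x i) := by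
    rw [Real.log_mul hA.ne' hP.ne', Real.log_prod fun i _ => (hpos i).ne']
    simp only [Real.log_zpow]
  rw [← hlog]
  constructor
  · intro h; rw [h, Real.log_one]
  · intro h
    rw [← Real.exp_log (mul_pos hA hP), h, Real.exp_zero]

open scoped Classical in
/-- Local connectedness at `x₀` of the set of interior points of a face of the orthant where binomials
with independent logarithmic differentials equal `1`. -/
lemma exists_preconnected_binomial {ι κ : Type*} [Fintype ι] [Fintype κ] {x₀ : ι → ℝ}
    (hx₀ : x₀ ∈ orthant ι) {J : Set ι} (hJ : ∀ j ∈ J, x₀ j = 0) {A : κ → (ι → ℝ) → ℝ}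
    (hA : ∀ k, ContDiffWithinAt ℝ ∞ (A k) (orthant ι) x₀) (hpos : ∀ k, 0 < A k x₀)
    {γ : κ → ι → ℤ} (hγ : ∀ k, ∀ j ∈ J, γ k j = 0)
    (hli : LinearIndependent ℝ fun k i =>
      (γ k i : ℝ) + x₀ i * fderivWithin ℝ (A k) (orthant ι) x₀ (Pi.single i 1) / A k x₀)
    {N : Set (ι → ℝ)} (hN : N ∈ 𝓝[orthant ι] x₀) :
    ∃ N' ∈ 𝓝[orthant ι] x₀, ∃ K, IsPreconnected K ∧
      (∀ x ∈ openFace J, x ∈ N' → (∀ k, A k x * ∏ i, x i ^ γ k i = 1) → x ∈ K) ∧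
      ∀ x ∈ K, x ∈ openFace J ∧ x ∈ N ∧ ∀ k, A k x * ∏ i, x i ^ γ k i = 1 := by
  -- Adding and subtracting ∑ β_i log x_i puts the full b-differential at x₀ into the linear part
  -- and leaves ψ with zero b-differential there. As β_i = 0 where x₀ i = 0, ψ stays smooth at x₀.
  set β : κ → ι → ℝ := fun k i =>
    -(x₀ i * fderivWithin ℝ (A k) (orthant ι) x₀ (Pi.single i 1) / A k x₀) with hβ
  have hβ0 : ∀ k i, x₀ i = 0 → β k i = 0 := fun k i hi => by simp [hβ, hi]
  set ψ : (ι → ℝ) → κ → ℝ := fun x k => ∑ i, β k i * Real.log (x i) + Real.log (A k x) with hψ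
  have hψs : ContDiffWithinAt ℝ ∞ ψ (orthant ι) x₀ := by
    refine contDiffWithinAt_pi.2 fun k => ContDiffWithinAt.add ?_ ((hA k).log (hpos k).ne')
    refine ContDiffWithinAt.sum fun i _ => ?_
    by_cases hi : x₀ i = 0
    · simp only [hβ0 k i hi, zero_mul]
      exact contDiffWithinAt_const
    · exact contDiffWithinAt_const.mul
        (ContDiffWithinAt.log (contDiff_apply ℝ ℝ i).contDiffWithinAt hi)
  have hψd : HasFDerivWithinAt ψ (ContinuousLinearMap.pi fun k =>
      ∑ i, (β k i * (x₀ i)⁻¹) • ContinuousLinearMap.proj (R := ℝ) (φ := fun _ : ι => ℝ) i +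
        (A k x₀)⁻¹ • fderivWithin ℝ (A k) (orthant ι) x₀) (orthant ι) x₀ := by
    refine hasFDerivWithinAt_pi.2 fun k => HasFDerivWithinAt.add ?_
      (((hA k).differentiableWithinAt (by simp)).hasFDerivWithinAt.log (hpos k).ne')
    refine HasFDerivWithinAt.fun_sum fun i _ => ?_
    by_cases hi : x₀ i = 0
    · simp only [hβ0 k i hi, zero_mul, zero_smul]
      exact hasFDerivWithinAt_const _ _ _
    · have := ((hasFDerivWithinAt_apply (𝕜 := ℝ) i x₀ (orthant ι)).log hi).const_mul (β k i)
      rw [smul_smul] at this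
      exact this
  have hψ0 : (fderivWithin ℝ ψ (orthant ι) x₀).comp (ContinuousLinearMap.mul ℝ (ι → ℝ) x₀) = 0 := by
    rw [hψd.fderivWithin (uniqueDiffOn_orthant ι x₀ hx₀)]
    refine ContinuousLinearMap.coe_injective (LinearMap.pi_ext' fun i => LinearMap.ext_ring ?_)
    funext k
    have h1 : x₀ * Pi.single i (1 : ℝ) = x₀ i • Pi.single i (1 : ℝ) := by
      funext l
      by_cases hl : l = i
      · subst hl; simp
      · simp [hl]
    have h2 : ∑ l, β k l * (x₀ l)⁻¹ * (Pi.single i (1 : ℝ) : ι → ℝ) l = β k i * (x₀ i)⁻¹ := by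
      rw [Finset.sum_eq_single i (fun l _ hl => by simp [hl]) (by simp)]
      simp
    change (∑ l, (β k l * (x₀ l)⁻¹) • ContinuousLinearMap.proj (R := ℝ) (φ := fun _ : ι => ℝ) l +
      (A k x₀)⁻¹ • fderivWithin ℝ (A k) (orthant ι) x₀) (x₀ * Pi.single i (1 : ℝ)) = 0
    rw [h1, map_smul, add_apply, sum_apply]
    simp only [smul_apply, ContinuousLinearMap.proj_apply, smul_eq_mul, h2]
    by_cases hi : x₀ i = 0
    · simp [hi]
    · have := (hpos k).ne'
      simp only [hβ]
      field_simp
      ring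
  have hBJ : ∀ k, ∀ j ∈ J, (γ k j : ℝ) +
      x₀ j * fderivWithin ℝ (A k) (orthant ι) x₀ (Pi.single j 1) / A k x₀ = 0 := fun k j hj => by
    simp [hγ k j hj, hJ j hj]
  have hAN : ∀ᶠ x in 𝓝[orthant ι] x₀, ∀ k, 0 < A k x :=
    eventually_all.2 fun k => (hA k).continuousWithinAt.eventually (lt_mem_nhds (hpos k))
  obtain ⟨N', hN', K, hK, hKin, hKout⟩ := exists_preconnected_log_solutions hx₀ hJ hli hBJ hψs hψ0
    (hAN.and hN)
  have hiff : ∀ x ∈ openFace J, (∀ k, 0 < A k x) → ((∀ k, A k x * ∏ i, x i ^ γ k i = 1) ↔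
      ∀ k, ∑ i, ((γ k i : ℝ) +
        x₀ i * fderivWithin ℝ (A k) (orthant ι) x₀ (Pi.single i 1) / A k x₀) * Real.log (x i) +
          ψ x k = 0) := by
    intro x hx hxA
    refine forall_congr' fun k => ?_
    rw [binomial_eq_one_iff hx (hγ k) (hxA k)]
    have : ∑ i, ((γ k i : ℝ) +
        x₀ i * fderivWithin ℝ (A k) (orthant ι) x₀ (Pi.single i 1) / A k x₀) * Real.log (x i) +
          ψ x k = Real.log (A k x) + ∑ i, (γ k i : ℝ) * Real.log (x i) := by
      simp only [hψ, hβ]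
      rw [← add_assoc, ← Finset.sum_add_distrib, add_comm]
      congr 1
      exact Finset.sum_congr rfl fun i _ => by ring
    rw [this]
  refine ⟨N' ∩ {x | ∀ k, 0 < A k x}, inter_mem hN' hAN, K, hK, ?_, ?_⟩
  · rintro x hx ⟨hxN, hxA⟩ hxs
    exact hKin x hx hxN ((hiff x hx hxA).1 hxs)
  · intro x hx
    obtain ⟨h1, ⟨h2, h3⟩, h4⟩ := hKout x hx
    exact ⟨h1, h3, (hiff x h1 h2).2 h4⟩

lemma closure_inter_open_inter {X : Type*} [TopologicalSpace X] (S : Set X) {U : Set X}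
    (hU : IsOpen U) : closure (S ∩ U) ∩ U = closure S ∩ U := by
  apply Subset.antisymm
  · exact inter_subset_inter_left _ (closure_mono inter_subset_left)
  · rintro x ⟨hx, hxU⟩
    refine ⟨?_, hxU⟩
    rw [inter_comm]
    exact hU.inter_closure ⟨hxU, hx⟩

/-! ### Connected components inherit local binomial structures. -/

section LocalStructure

variable {E H M : Type*} [NormedAddCommGroup E] [NormedSpace ℝ E] [TopologicalSpace H]
  [TopologicalSpace M] [ChartedSpace H M] {I : ModelWithCorners ℝ E H}
  {ι : Type} [Fintype ι] [CornerModel I ι] [IsManifold I ∞ M]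

variable (I) in
/-- Local connectedness at `p` of the set of points in the interior of a coordinate face where
binomials with independent logarithmic differentials equal `1`. -/
lemma exists_preconnected_binomial_chart {e : OpenPartialHomeomorph M H}
    (he : e ∈ IsManifold.maximalAtlas I ∞ M) {p : M} (hp : p ∈ e.source) {J : Set ι}
    (hJ : ∀ j ∈ J, xcoord I e j p = 0) {κ : Type*} [Fintype κ] {a : κ → M → ℝ} {γ : κ → ι → ℤ}
    (ha : ∀ k, ContMDiffAt I 𝓘(ℝ, ℝ) ∞ (a k) p) (hpos : ∀ k, 0 < a k p)
    (hγ : ∀ k, ∀ j ∈ J, γ k j = 0)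
    (hli : LinearIndependent ℝ fun k => bLogDiff I e (a k) (γ k) p) :
    ∃ N ∈ 𝓝 p, ∃ K, IsPreconnected K ∧
      (∀ q ∈ N, cmap I e q ∈ openFace J → (∀ k, a k q * ∏ i, xcoord I e i q ^ γ k i = 1) → q ∈ K) ∧
      ∀ q ∈ K, q ∈ e.source ∧ cmap I e q ∈ openFace J ∧
        ∀ k, a k q * ∏ i, xcoord I e i q ^ γ k i = 1 := by
  classical
  have h1 : ∀ k, (a k ∘ cinv I e) (cmap I e p) = a k p := fun k => by
    rw [Function.comp, cinv_cmap I hp]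
  have hli' : LinearIndependent ℝ fun k i => (γ k i : ℝ) + cmap I e p i *
      fderivWithin ℝ (a k ∘ cinv I e) (orthant ι) (cmap I e p) (Pi.single i 1) /
        (a k ∘ cinv I e) (cmap I e p) := by
    convert hli using 3 with k i
    rw [bLogDiff, pderiv_eq, h1]
    congr!
  obtain ⟨N', hN', K, hK, hKin, hKout⟩ := exists_preconnected_binomial
    (cmap_mem_orthant I e p) hJ (A := fun k => a k ∘ cinv I e)
    (fun k => contDiffWithinAt_comp_cinv I he hp (ha k))
    (fun k => by rw [h1]; exact hpos k) hγ (by convert hli') (eventually_cmap_cinv I hp)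
  refine ⟨cmap I e ⁻¹' N' ∩ e.source, inter_mem ((tendsto_cmap I hp) hN')
    (e.open_source.mem_nhds hp), cinv I e '' K, hK.image _ ?_, ?_, ?_⟩
  · intro x hx
    obtain ⟨h2, ⟨h3, h4⟩, -⟩ := hKout x hx
    have := tendsto_cinv I h4
    rw [h3] at this
    refine ContinuousWithinAt.mono this fun y hy i => ?_
    have hy' := (hKout y hy).1 i
    by_cases hi : i ∈ J
    · rw [hy'.1 hi]
    · exact (hy'.2 hi).le
  · rintro q ⟨hqN, hqe⟩ hqJ hq
    refine ⟨cmap I e q, hKin _ hqJ hqN fun k => ?_, cinv_cmap I hqe⟩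
    rw [Function.comp, cinv_cmap I hqe]
    exact hq k
  · rintro _ ⟨x, hx, rfl⟩
    obtain ⟨h2, ⟨h3, h4⟩, h5⟩ := hKout x hx
    refine ⟨h4, by rwa [h3], fun k => ?_⟩
    have := h5 k
    rw [← h3] at this
    simp only [Function.comp, cinv_cmap I h4] at this
    exact this

/-- A connected component of a closed set with local binomial structures inherits them. -/
lemma HasLocalBinomialStructureAt.connectedComponentIn {G D : Set M} (hD : IsClosed D) {p q : M}
    (hpq : p ∈ connectedComponentIn D q) (h : HasLocalBinomialStructureAt I G D p) :
    HasLocalBinomialStructureAt I G (connectedComponentIn D q) p := by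
  obtain ⟨e, he, hpe, J, hG, d, a, γ, ha, hpos, hγ, hli, hDe⟩ := h
  have hpD : p ∈ D := connectedComponentIn_subset D q hpq
  set S : Set M := {q | q ∈ G ∩ e.source ∧ (∀ i, i ∉ J → 0 < xcoord I e i q) ∧
          ∀ k, a k q * ∏ i, xcoord I e i q ^ γ k i = 1} with hS
  have hSD : S ⊆ D := fun x hx => by
    have : x ∈ D ∩ e.source := by
      rw [hDe]
      exact ⟨subset_closure hx, hx.1.2⟩
    exact this.1
  have hpG : p ∈ closure S := by
    have : p ∈ D ∩ e.source := ⟨hpD, hpe⟩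
    rw [hDe] at this
    exact this.1
  have hJp : ∀ j ∈ J, xcoord I e j p = 0 := by
    intro j hj
    by_contra hne
    obtain ⟨x, hxS, hx⟩ := ((mem_closure_iff_frequently.1 hpG).and_eventually
      ((continuousAt_xcoord I hpe j).eventually_ne hne)).exists
    have := hxS.1
    rw [hG] at this
    exact hx (this.2 j hj)
  obtain ⟨N, hN, K, hK, hKin, hKout⟩ := exists_preconnected_binomial_chart I he hpe hJp
    (fun k => (ha k).contMDiffAt (e.open_source.mem_nhds hpe)) (fun k => hpos k p hpe) hγ
    (hli p ⟨hpD, hpe⟩)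
  have hKS : K ⊆ S := by
    intro x hx
    obtain ⟨h1, h2, h3⟩ := hKout x hx
    refine ⟨?_, fun i hi => (h2 i).2 hi, h3⟩
    rw [hG]
    exact ⟨h1, fun j hj => (h2 j).1 hj⟩
  obtain ⟨U, hUN, hUo, hpU⟩ := mem_nhds_iff.1 (inter_mem hN (e.open_source.mem_nhds hpe))
  have hSU : S ∩ U ⊆ K := by
    rintro x ⟨hxS, hxU⟩
    have hxG := hxS.1
    rw [hG] at hxG
    exact hKin x (hUN hxU).1 (fun i => ⟨fun hi => hxG.2 i hi, hxS.2.1 i⟩) hxS.2.2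
  have hDU : D ∩ U = closure S ∩ U := by
    have h1 : U = e.source ∩ U := (inter_eq_right.2 fun x hx => (hUN hx).2).symm
    rw [h1, ← inter_assoc, ← inter_assoc, hDe]
  have hpK : p ∈ closure K := by
    have : p ∈ closure S ∩ U := ⟨hpG, hpU⟩
    rw [← closure_inter_open_inter S hUo] at this
    exact closure_mono hSU this.1
  -- The closure of K is a connected subset of D through p, hence lies in the component. It contains
  -- D ∩ U, so component and set agree on U, and the same binomials serve both.
  have hKC : closure K ⊆ _root_.connectedComponentIn D q := by
    rw [connectedComponentIn_eq hpq]
    exact hK.closure.subset_connectedComponentIn hpK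
      (closure_minimal (hKS.trans hSD) hD)
  have hCU : _root_.connectedComponentIn D q ∩ U = closure S ∩ U := by
    apply Subset.antisymm
    · rw [← hDU]
      exact inter_subset_inter_left _ (connectedComponentIn_subset D q)
    · rintro x ⟨hxS, hxU⟩
      have : x ∈ closure S ∩ U := ⟨hxS, hxU⟩
      rw [← closure_inter_open_inter S hUo] at this
      exact ⟨hKC (closure_mono hSU this.1), hxU⟩
  have hsrc : (e.restr U).source = U := by
    rw [e.restr_source' U hUo]
    exact inter_eq_right.2 fun x hx => (hUN hx).2
  refine ⟨e.restr U, restr_mem_maximalAtlas _ he hUo, ?_, J, ?_, d, a, γ,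
    ?_, ?_, hγ, ?_, ?_⟩
  · rw [hsrc]; exact hpU
  · rw [hsrc]
    have h1 : U = e.source ∩ U := (inter_eq_right.2 fun x hx => (hUN hx).2).symm
    conv_lhs => rw [h1, ← inter_assoc, hG]
    ext x
    constructor
    · rintro ⟨hx, hxU⟩
      exact ⟨hxU, hx.2⟩
    · rintro ⟨hxU, hx⟩
      exact ⟨⟨(hUN hxU).2, hx⟩, hxU⟩
  · rw [hsrc]
    exact fun k => (ha k).mono fun x hx => (hUN hx).2
  · rw [hsrc]
    exact fun k x hx => hpos k x (hUN hx).2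
  · rw [hsrc]
    exact fun x hx => hli x ⟨connectedComponentIn_subset D q hx.1, (hUN hx.2).2⟩
  · rw [hsrc, hCU, ← closure_inter_open_inter S hUo]
    congr 2
    ext x
    constructor
    · rintro ⟨hx, hxU⟩
      exact ⟨⟨hx.1.1, hxU⟩, hx.2⟩
    · rintro ⟨hx, hx'⟩
      exact ⟨⟨⟨hx.1, (hUN hx.2).2⟩, hx'⟩, hx.2⟩

/-- Closedness: the closure of a component of a closed D is connected and stays in D, so it adds
nothing. -/
lemma isInteriorBinomialSubvariety_connectedComponentIn {G D : Set M} (hD : IsClosed D)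
    (hDG : D ⊆ G) (h : ∀ p ∈ D, HasLocalBinomialStructureAt I G D p) {p : M} (hp : p ∈ D) :
    IsInteriorBinomialSubvariety I G (connectedComponentIn D p) where
  subset := (connectedComponentIn_subset D p).trans hDG
  isClosed := isClosed_of_closure_subset <|
    isPreconnected_connectedComponentIn.closure.subset_connectedComponentIn
      (subset_closure (mem_connectedComponentIn hp))
      (closure_minimal (connectedComponentIn_subset D p) hD)
  isConnected := isConnected_connectedComponentIn_iff.2 hp
  local_structure q hq := (h q (connectedComponentIn_subset D p hq)).connectedComponentIn hD hq

end LocalStructure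

/-! ### Interiors of faces in coordinates. -/

section FaceInterior

variable {E H M : Type*} [NormedAddCommGroup E] [NormedSpace ℝ E] [TopologicalSpace H]
  [TopologicalSpace M] [ChartedSpace H M] {I : ModelWithCorners ℝ E H}
  {ι : Type} [Fintype ι] [CornerModel I ι]

lemma IsFaceOfCodim.isClosed {k : ℕ} {F : Set M} (hF : IsFaceOfCodim I k F) : IsClosed F := by
  obtain ⟨p, -, rfl⟩ := hF
  exact isClosed_closure

lemma IsFaceOfCodim.exists_bdryCodim_eq {k : ℕ} {F : Set M} (hF : IsFaceOfCodim I k F) :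
    ∃ q ∈ F, bdryCodim I q = k := by
  obtain ⟨p, hp, rfl⟩ := hF
  exact ⟨p, subset_closure (mem_connectedComponentIn hp), hp⟩

variable (I) in
lemma exists_isFaceOfCodim (p : M) : ∃ F : Set M, IsFaceOfCodim I (bdryCodim I p) F ∧ p ∈ F :=
  ⟨_, ⟨p, rfl, rfl⟩, subset_closure (mem_connectedComponentIn (F := {_q : M | _}) rfl)⟩

variable [IsManifold I ∞ M]

/-- Near each of its points, a boundary face of codimension `k` and its interior are described by
the vanishing of `k` coordinates. -/
lemma HasEmbeddedHypersurfaces.exists_face_interior_coords (hM : HasEmbeddedHypersurfaces I M)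
    {k : ℕ} {F : Set M} (hF : IsFaceOfCodim I k F) {p : M} (hp : p ∈ F)
    {e : OpenPartialHomeomorph M H} (he : e ∈ IsManifold.maximalAtlas I ∞ M) (hpe : p ∈ e.source) :
    ∃ J : Set ι, (∀ j ∈ J, xcoord I e j p = 0) ∧
      ∀ᶠ q in 𝓝 p, (q ∈ F ↔ ∀ j ∈ J, xcoord I e j q = 0) ∧
        (q ∈ F ∧ bdryCodim I q = k ↔ cmap I e q ∈ openFace J) := by
  obtain ⟨J, rfl, hJ, hev⟩ := hM.exists_face_coords hF hp he hpe
  refine ⟨J, hJ, ?_⟩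
  filter_upwards [hev, e.open_source.mem_nhds hpe] with q hq hqe
  refine ⟨hq, ?_⟩
  rw [hq, bdryCodim_eq I he hqe]
  constructor
  · rintro ⟨h1, h2⟩ i
    refine ⟨h1 i, fun hi => lt_of_le_of_ne (xcoord_nonneg I e i q) fun h => hi ?_⟩
    rw [eq_of_subset_of_ncard_le h1 h2.le (toFinite _)]
    exact h.symm
  · intro h
    refine ⟨fun j hj => (h j).1 hj, ?_⟩
    congr 1
    ext i
    exact ⟨fun h1 => by_contra fun hi => ((h i).2 hi).ne' h1, fun hi => (h i).1 hi⟩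

end FaceInterior

/-! ### Codimension and logarithmic differentials on products. -/

section Products

variable {E₁ H₁ X₁ E₂ H₂ X₂ : Type*}
  [NormedAddCommGroup E₁] [NormedSpace ℝ E₁] [TopologicalSpace H₁] [TopologicalSpace X₁]
  (I₁ : ModelWithCorners ℝ E₁ H₁) {ι₁ : Type} [Fintype ι₁] [CornerModel I₁ ι₁]
  [NormedAddCommGroup E₂] [NormedSpace ℝ E₂] [TopologicalSpace H₂] [TopologicalSpace X₂]
  (I₂ : ModelWithCorners ℝ E₂ H₂) {ι₂ : Type} [Fintype ι₂] [CornerModel I₂ ι₂]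

lemma xcoord_prod_inl (e₁ : OpenPartialHomeomorph X₁ H₁) (e₂ : OpenPartialHomeomorph X₂ H₂)
    (i : ι₁) (q : X₁ × X₂) :
    xcoord (I₁.prod I₂) (e₁.prod e₂) (Sum.inl i) q = xcoord I₁ e₁ i q.1 := rfl

lemma xcoord_prod_inr (e₁ : OpenPartialHomeomorph X₁ H₁) (e₂ : OpenPartialHomeomorph X₂ H₂)
    (i : ι₂) (q : X₁ × X₂) :
    xcoord (I₁.prod I₂) (e₁.prod e₂) (Sum.inr i) q = xcoord I₂ e₂ i q.2 := rfl

lemma cinv_prod (e₁ : OpenPartialHomeomorph X₁ H₁) (e₂ : OpenPartialHomeomorph X₂ H₂)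
    (x : ι₁ ⊕ ι₂ → ℝ) :
    cinv (I₁.prod I₂) (e₁.prod e₂) x =
      (cinv I₁ e₁ fun i => x (Sum.inl i), cinv I₂ e₂ fun i => x (Sum.inr i)) := rfl

variable [ChartedSpace H₁ X₁] [ChartedSpace H₂ X₂]

lemma bdryCodim_prod (q : X₁ × X₂) :
    bdryCodim (I₁.prod I₂) q = bdryCodim I₁ q.1 + bdryCodim I₂ q.2 := by
  have h : {s : ι₁ ⊕ ι₂ | xcoord (I₁.prod I₂) (chartAt (ModelProd H₁ H₂) q) s q = 0} =
      Sum.inl '' {i : ι₁ | xcoord I₁ (chartAt H₁ q.1) i q.1 = 0} ∪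
        Sum.inr '' {i : ι₂ | xcoord I₂ (chartAt H₂ q.2) i q.2 = 0} := by
    rw [prodChartedSpace_chartAt]
    ext (i | i)
    · simp [xcoord_prod_inl]
    · simp [xcoord_prod_inr]
  rw [bdryCodim, h, ncard_union_eq ?_ (toFinite _) (toFinite _),
    ncard_image_of_injective _ Sum.inl_injective, ncard_image_of_injective _ Sum.inr_injective]
  · rfl
  · rw [Set.disjoint_left]
    rintro _ ⟨i, -, rfl⟩ ⟨j, -, h⟩
    cases h

/-- Codimension is additive, and k₁, k₂ are the attained minima on the factors, so the sum is
minimal exactly when both terms are. -/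
lemma notMem_faceBoundary_prod_iff [IsManifold I₁ ∞ X₁] [IsManifold I₂ ∞ X₂]
    (hX₁ : HasEmbeddedHypersurfaces I₁ X₁) (hX₂ : HasEmbeddedHypersurfaces I₂ X₂) {k₁ k₂ : ℕ}
    {F₁ : Set X₁} (hF₁ : IsFaceOfCodim I₁ k₁ F₁) {F₂ : Set X₂} (hF₂ : IsFaceOfCodim I₂ k₂ F₂)
    {q : X₁ × X₂} (hq : q ∈ F₁ ×ˢ F₂) :
    q ∉ faceBoundary (I₁.prod I₂) (F₁ ×ˢ F₂) ↔ bdryCodim I₁ q.1 = k₁ ∧ bdryCodim I₂ q.2 = k₂ := by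
  have h₁ := hX₁.le_bdryCodim hF₁ hq.1
  have h₂ := hX₂.le_bdryCodim hF₂ hq.2
  constructor
  · intro h
    obtain ⟨r₁, hr₁, hk₁⟩ := hF₁.exists_bdryCodim_eq
    obtain ⟨r₂, hr₂, hk₂⟩ := hF₂.exists_bdryCodim_eq
    have h3 : ¬ bdryCodim (I₁.prod I₂) (r₁, r₂) < bdryCodim (I₁.prod I₂) q := fun hlt =>
      h ⟨hq, (r₁, r₂), ⟨hr₁, hr₂⟩, hlt⟩
    rw [bdryCodim_prod, bdryCodim_prod, hk₁, hk₂] at h3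
    omega
  · rintro ⟨h3, h4⟩ ⟨-, r, hr, hlt⟩
    have h5 := hX₁.le_bdryCodim hF₁ hr.1
    have h6 := hX₂.le_bdryCodim hF₂ hr.2
    rw [bdryCodim_prod, bdryCodim_prod] at hlt
    omega

variable [IsManifold I₁ ∞ X₁] [IsManifold I₂ ∞ X₂]

/-- The logarithmic differential of a quotient of functions pulled back from the factors. -/
lemma bLogDiff_prod {e₁ : OpenPartialHomeomorph X₁ H₁} (he₁ : e₁ ∈ IsManifold.maximalAtlas I₁ ∞ X₁)
    {e₂ : OpenPartialHomeomorph X₂ H₂} (he₂ : e₂ ∈ IsManifold.maximalAtlas I₂ ∞ X₂)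
    {q : X₁ × X₂} (hq₁ : q.1 ∈ e₁.source) (hq₂ : q.2 ∈ e₂.source) {a : X₁ → ℝ} {b : X₂ → ℝ}
    (ha : ContMDiffAt I₁ 𝓘(ℝ, ℝ) ∞ a q.1) (hb : ContMDiffAt I₂ 𝓘(ℝ, ℝ) ∞ b q.2)
    (ha0 : a q.1 ≠ 0) (hb0 : b q.2 ≠ 0) (α : ι₁ → ℤ) (β : ι₂ → ℤ) :
    bLogDiff (I₁.prod I₂) (e₁.prod e₂) (fun q => a q.1 / b q.2) (Sum.elim α (-β)) q =
      Sum.elim (bLogDiff I₁ e₁ a α q.1) (-bLogDiff I₂ e₂ b β q.2) := by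
  classical
  let pl : (ι₁ ⊕ ι₂ → ℝ) →L[ℝ] (ι₁ → ℝ) :=
    ContinuousLinearMap.pi fun i => ContinuousLinearMap.proj (Sum.inl i)
  let pr : (ι₁ ⊕ ι₂ → ℝ) →L[ℝ] (ι₂ → ℝ) :=
    ContinuousLinearMap.pi fun i => ContinuousLinearMap.proj (Sum.inr i)
  set x := cmap (I₁.prod I₂) (e₁.prod e₂) q with hx
  have hA := ((contDiffWithinAt_comp_cinv I₁ he₁ hq₁ ha).differentiableWithinAt
    (by simp)).hasFDerivWithinAt
  have hB := ((contDiffWithinAt_comp_cinv I₂ he₂ hq₂ hb).differentiableWithinAt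
    (by simp)).hasFDerivWithinAt
  have hxl : pl x = cmap I₁ e₁ q.1 := rfl
  have hxr : pr x = cmap I₂ e₂ q.2 := rfl
  have hA' := HasFDerivWithinAt.comp (t := orthant ι₁) (s := orthant (ι₁ ⊕ ι₂)) x
    (g := a ∘ cinv I₁ e₁) hA pl.hasFDerivWithinAt fun y hy i => hy (Sum.inl i)
  have hB' := HasFDerivWithinAt.comp (t := orthant ι₂) (s := orthant (ι₁ ⊕ ι₂)) x
    (g := b ∘ cinv I₂ e₂) hB pr.hasFDerivWithinAt fun y hy i => hy (Sum.inr i)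
  have hAx : ((a ∘ cinv I₁ e₁) ∘ pl) x = a q.1 := by
    simp only [Function.comp, hxl, cinv_cmap I₁ hq₁]
  have hBx : ((b ∘ cinv I₂ e₂) ∘ pr) x = b q.2 := by
    simp only [Function.comp, hxr, cinv_cmap I₂ hq₂]
  have hBi := (hasDerivAt_inv (by rw [hBx]; exact hb0)).comp_hasFDerivWithinAt x hB'
  have hu : (fun q : X₁ × X₂ => a q.1 / b q.2) ∘ cinv (I₁.prod I₂) (e₁.prod e₂) =
      ((a ∘ cinv I₁ e₁) ∘ pl) * (Inv.inv ∘ ((b ∘ cinv I₂ e₂) ∘ pr)) := by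
    funext y
    rw [Function.comp, cinv_prod]
    exact div_eq_mul_inv _ _
  have hd := (hA'.mul hBi).fderivWithin (uniqueDiffOn_orthant _ x (cmap_mem_orthant _ _ _))
  rw [← hu, Function.comp_apply (f := Inv.inv), hAx, hBx] at hd
  have hp : ∀ s, pderiv (I₁.prod I₂) (e₁.prod e₂) (fun q => a q.1 / b q.2) s q =
      a q.1 * (-(b q.2 ^ 2)⁻¹ * fderivWithin ℝ (b ∘ cinv I₂ e₂) (orthant ι₂) (cmap I₂ e₂ q.2)
        (pr (Pi.single s 1))) +
      (b q.2)⁻¹ * fderivWithin ℝ (a ∘ cinv I₁ e₁) (orthant ι₁) (cmap I₁ e₁ q.1)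
        (pl (Pi.single s 1)) := fun s => by
    rw [pderiv_eq]
    refine (congrArg (fderivWithin ℝ _ _ _) (by congr!)).trans (DFunLike.congr_fun hd _)
  funext s
  rcases s with i | i
  · have h1 : pl (Pi.single (Sum.inl i) 1) = Pi.single i 1 := by
      funext l
      by_cases hl : l = i
      · subst hl; simp [pl]
      · simp [pl, hl]
    have h2 : pr (Pi.single (Sum.inl i) 1) = 0 := by
      funext l
      simp [pr]
    have h3 : pderiv I₁ e₁ a i q.1 = fderivWithin ℝ (a ∘ cinv I₁ e₁) (orthant ι₁)
        (cmap I₁ e₁ q.1) (Pi.single i 1) := by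
      rw [pderiv_eq]
    simp only [bLogDiff, hp, h1, h2, map_zero, Sum.elim_inl, h3, xcoord_prod_inl]
    field_simp
    ring
  · have h1 : pr (Pi.single (Sum.inr i) 1) = Pi.single i 1 := by
      funext l
      by_cases hl : l = i
      · subst hl; simp [pr]
      · simp [pr, hl]
    have h2 : pl (Pi.single (Sum.inr i) 1) = 0 := by
      funext l
      simp [pl]
    have h3 : pderiv I₂ e₂ b i q.2 = fderivWithin ℝ (b ∘ cinv I₂ e₂) (orthant ι₂)
        (cmap I₂ e₂ q.2) (Pi.single i 1) := by
      rw [pderiv_eq]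
    simp only [bLogDiff, hp, h1, h2, map_zero, Sum.elim_inr, h3, xcoord_prod_inr, Pi.neg_apply]
    push_cast
    field_simp
    ring

end Products

/-! ### The fiber product and its binomial equations. -/

section FiberProduct

variable {E₁ H₁ X₁ E₂ H₂ X₂ E H Y : Type*}
  [NormedAddCommGroup E₁] [NormedSpace ℝ E₁] [TopologicalSpace H₁]
  [TopologicalSpace X₁] [ChartedSpace H₁ X₁] {I₁ : ModelWithCorners ℝ E₁ H₁}
  {ι₁ : Type} [Fintype ι₁] [CornerModel I₁ ι₁]
  [NormedAddCommGroup E₂] [NormedSpace ℝ E₂] [TopologicalSpace H₂]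
  [TopologicalSpace X₂] [ChartedSpace H₂ X₂] {I₂ : ModelWithCorners ℝ E₂ H₂}
  {ι₂ : Type} [Fintype ι₂] [CornerModel I₂ ι₂]
  [NormedAddCommGroup E] [NormedSpace ℝ E] [TopologicalSpace H]
  [TopologicalSpace Y] [ChartedSpace H Y] {I : ModelWithCorners ℝ E H}
  {ι : Type} [Fintype ι] [CornerModel I ι]

/-- In local coordinates, b-transversality says that the logarithmic differentials of the quotients of
the components of the two maps are independent. -/
lemma BTransversal.linearIndependent {f₁ : X₁ → Y} {f₂ : X₂ → Y} (hf : BTransversal I₁ I₂ I f₁ f₂)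
    {p₁ : X₁} {p₂ : X₂} (hp : f₁ p₁ = f₂ p₂) {α : ι → ι₁ → ℕ} {a : ι → X₁ → ℝ}
    (ha : HasBLocalForm I₁ I f₁ p₁ α a) {β : ι → ι₂ → ℕ} {b : ι → X₂ → ℝ}
    (hb : HasBLocalForm I₂ I f₂ p₂ β b) :
    LinearIndependent ℝ fun j : ι => (Sum.elim
      (bLogDiff I₁ (chartAt H₁ p₁) (a j) (fun i => (α j i : ℤ)) p₁)
      (-bLogDiff I₂ (chartAt H₂ p₂) (b j) (fun i => (β j i : ℤ)) p₂) : ι₁ ⊕ ι₂ → ℝ) := by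
  apply linearIndependent_of_mulVec_surjective
  intro w
  have h := hf p₁ p₂ hp
    (Matrix.mulVecLin (Matrix.of fun j i =>
      bLogDiff I₁ (chartAt H₁ p₁) (a j) (fun i => (α j i : ℤ)) p₁ i))
    (Matrix.mulVecLin (Matrix.of fun j i =>
      bLogDiff I₂ (chartAt H₂ p₂) (b j) (fun i => (β j i : ℤ)) p₂ i))
    ⟨α, a, ha, fun v j => rfl⟩ ⟨β, b, hb, fun v j => rfl⟩
  have hw : w ∈ (⊤ : Submodule ℝ (ι → ℝ)) := trivial
  rw [← h] at hw
  obtain ⟨_, ⟨v₁, rfl⟩, _, ⟨v₂, rfl⟩, hv⟩ := Submodule.mem_sup.1 hw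
  -- The sign cancels the minus in the second block, giving L₁ v₁ + L₂ v₂ = w.
  refine ⟨Sum.elim v₁ (-v₂), ?_⟩
  rw [← hv]
  funext j
  simp only [Fintype.sum_sum_type, Sum.elim_inl, Sum.elim_inr, Pi.neg_apply, neg_mul_neg]
  rfl

lemma isClosed_fiberProduct [T2Space Y] {f₁ : X₁ → Y} {f₂ : X₂ → Y} (hf₁ : Continuous f₁)
    (hf₂ : Continuous f₂) {F₁ : Set X₁} {F₂ : Set X₂} (hF₁ : IsClosed F₁) (hF₂ : IsClosed F₂) :
    IsClosed (fiberProduct f₁ f₂ F₁ F₂) :=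
  (hF₁.prod hF₂).inter (isClosed_eq (hf₁.comp continuous_fst) (hf₂.comp continuous_snd))

lemma fiberComponent_subset_fiberProduct [T2Space Y] {f₁ : X₁ → Y} {f₂ : X₂ → Y}
    (hf₁ : Continuous f₁) (hf₂ : Continuous f₂) {F₁ : Set X₁} {F₂ : Set X₂} (hF₁ : IsClosed F₁)
    (hF₂ : IsClosed F₂) :
    fiberComponent I₁ I₂ f₁ f₂ F₁ F₂ ⊆ fiberProduct f₁ f₂ F₁ F₂ :=
  closure_minimal sdiff_subset (isClosed_fiberProduct hf₁ hf₂ hF₁ hF₂)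

/-- A local form shows on which open faces a coordinate of the target vanishes. -/
lemma mul_prod_pow_eq_zero_iff {ι : Type*} [Fintype ι] {J : Set ι} {x : ι → ℝ}
    (hx : x ∈ openFace J) {α : ι → ℕ} {c : ℝ} (hc : 0 < c) :
    c * ∏ i, x i ^ α i = 0 ↔ ∃ i ∈ J, α i ≠ 0 := by
  rw [mul_eq_zero, or_iff_right hc.ne', Finset.prod_eq_zero_iff]
  refine exists_congr fun i => ?_
  rw [pow_eq_zero_iff', and_iff_right (Finset.mem_univ i)]
  refine and_congr_left fun _ => ⟨fun h => by_contra fun hi => ((hx i).2 hi).ne' h, (hx i).1⟩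

lemma mul_prod_zpow_sum_eq_one_iff {ι₁ ι₂ : Type*} [Fintype ι₁] [Fintype ι₂] {x : ι₁ → ℝ}
    {z : ι₂ → ℝ} {α : ι₁ → ℕ} {β : ι₂ → ℕ} {a b : ℝ} (hz : b * ∏ i, z i ^ β i ≠ 0) :
    a / b * ∏ s, Sum.elim x z s ^ (Sum.elim (fun i => (α i : ℤ)) (-fun i => (β i : ℤ)) s) = 1 ↔
      a * ∏ i, x i ^ α i = b * ∏ i, z i ^ β i := by
  have h : a / b * ∏ s, Sum.elim x z s ^ (Sum.elim (fun i => (α i : ℤ)) (-fun i => (β i : ℤ)) s) =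
      (a * ∏ i, x i ^ α i) / (b * ∏ i, z i ^ β i) := by
    simp only [Fintype.prod_sum_type, Sum.elim_inl, Sum.elim_inr, Pi.neg_apply, zpow_neg,
      zpow_natCast, Finset.prod_inv_distrib]
    rw [← div_eq_mul_inv, div_mul_div_comm]
  rw [h, div_eq_one_iff_eq hz]

variable [IsManifold I₁ ∞ X₁] [IsManifold I₂ ∞ X₂]

/-- The sets `D(F₁, F₂)` have local binomial structures. -/
lemma hasLocalBinomialStructureAt_fiberComponent [T2Space Y]
    (hX₁ : HasEmbeddedHypersurfaces I₁ X₁) (hX₂ : HasEmbeddedHypersurfaces I₂ X₂)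
    {f₁ : X₁ → Y} {f₂ : X₂ → Y} (hf₁ : IsInteriorBMap I₁ I f₁) (hf₂ : IsInteriorBMap I₂ I f₂)
    (hf : BTransversal I₁ I₂ I f₁ f₂) {k₁ k₂ : ℕ}
    {F₁ : Set X₁} (hF₁ : IsFaceOfCodim I₁ k₁ F₁) {F₂ : Set X₂} (hF₂ : IsFaceOfCodim I₂ k₂ F₂)
    {p : X₁ × X₂} (hp : p ∈ fiberComponent I₁ I₂ f₁ f₂ F₁ F₂) :
    HasLocalBinomialStructureAt (I₁.prod I₂) (F₁ ×ˢ F₂) (fiberComponent I₁ I₂ f₁ f₂ F₁ F₂) p := by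
  classical
  obtain ⟨p₁, p₂⟩ := p
  have hc₁ := hf₁.contMDiff.continuous
  have hc₂ := hf₂.contMDiff.continuous
  obtain ⟨⟨hpF₁, hpF₂⟩, hpq⟩ := fiberComponent_subset_fiberProduct hc₁ hc₂
    hF₁.isClosed hF₂.isClosed hp
  dsimp only at hpF₁ hpF₂ hpq
  have hm₁ := mem_chart_source H₁ p₁
  have hm₂ := mem_chart_source H₂ p₂
  have he₁ := IsManifold.chart_mem_maximalAtlas (I := I₁) (n := ∞) p₁
  have he₂ := IsManifold.chart_mem_maximalAtlas (I := I₂) (n := ∞) p₂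
  set e₁ := chartAt H₁ p₁ with he₁'
  set e₂ := chartAt H₂ p₂ with he₂'
  set e := e₁.prod e₂ with he'
  have he : e ∈ IsManifold.maximalAtlas (I₁.prod I₂) ∞ (X₁ × X₂) :=
    IsManifold.mem_maximalAtlas_prod he₁ he₂
  have hpe : (p₁, p₂) ∈ e.source := ⟨hm₁, hm₂⟩
  obtain ⟨α, a, ha⟩ := hf₁.local_form p₁
  obtain ⟨β, b, hb⟩ := hf₂.local_form p₂
  have hli := hf.linearIndependent hpq ha hb
  obtain ⟨J₁, hJ₁, hev₁⟩ := hX₁.exists_face_interior_coords hF₁ hpF₁ he₁ hm₁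
  obtain ⟨J₂, hJ₂, hev₂⟩ := hX₂.exists_face_interior_coords hF₂ hpF₂ he₂ hm₂
  -- The binomials
  set c : ι → X₁ × X₂ → ℝ := fun j q => a j q.1 / b j q.2 with hc
  set γ : ι → ι₁ ⊕ ι₂ → ℤ := fun j =>
    Sum.elim (fun i => (α j i : ℤ)) (-fun i => (β j i : ℤ)) with hγ
  have ha' := ha.self_of_nhds
  have hb' := hb.self_of_nhds
  have hli' : LinearIndependent ℝ fun j => bLogDiff (I₁.prod I₂) e (c j) (γ j) (p₁, p₂) := by
    convert hli using 2 with j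
    exact bLogDiff_prod I₁ I₂ he₁ he₂ hm₁ hm₂ (ha' j).1 (hb' j).1 (ha' j).2.1.ne' (hb' j).2.1.ne'
      _ _
  have hcs : ∀ q : X₁ × X₂, ∀ j, ContMDiffAt I₁ 𝓘(ℝ, ℝ) ∞ (a j) q.1 →
      ContMDiffAt I₂ 𝓘(ℝ, ℝ) ∞ (b j) q.2 → 0 < b j q.2 →
        ContMDiffAt (I₁.prod I₂) 𝓘(ℝ, ℝ) ∞ (c j) q := fun q j h1 h2 h3 =>
    (h1.comp q contMDiffAt_fst).div₀ (h2.comp q contMDiffAt_snd) h3.ne'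
  have hlic : ∀ᶠ q in 𝓝 (p₁, p₂),
      LinearIndependent ℝ fun j => bLogDiff (I₁.prod I₂) e (c j) (γ j) q := by
    have h1 : ContinuousAt (fun q j => bLogDiff (I₁.prod I₂) e (c j) (γ j) q) (p₁, p₂) :=
      continuousAt_pi.2 fun j => continuousAt_bLogDiff (I₁.prod I₂) he hpe
        (hcs _ j (ha' j).1 (hb' j).1 (hb' j).2.1) (div_pos (ha' j).2.1 (hb' j).2.1).ne' _
    exact h1.eventually hli'.eventually
  have hs₁ : ∀ᶠ q₁ in 𝓝 p₁, f₁ q₁ ∈ (chartAt H (f₁ p₁)).source :=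
    hc₁.continuousAt.eventually ((chartAt H (f₁ p₁)).open_source.mem_nhds (mem_chart_source H _))
  have hs₂ : ∀ᶠ q₂ in 𝓝 p₂, f₂ q₂ ∈ (chartAt H (f₁ p₁)).source := by
    rw [hpq]
    exact hc₂.continuousAt.eventually
      ((chartAt H (f₂ p₂)).open_source.mem_nhds (mem_chart_source H _))
  rw [HasBLocalForm] at ha hb
  -- Both local forms now use the same chart of Y.
  rw [← hpq] at hb
  have hes : ∀ᶠ q in 𝓝 (p₁, p₂), q ∈ e.source := e.open_source.mem_nhds hpe
  obtain ⟨U, hU, hUo, hpU⟩ := eventually_nhds_iff.1 ((hes.and hlic).and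
    (((ha.and (hev₁.and hs₁)).prod_inl_nhds p₂).and ((hb.and (hev₂.and hs₂)).prod_inr_nhds p₁)))
  set S := fiberProduct f₁ f₂ F₁ F₂ \ faceBoundary (I₁.prod I₂) (F₁ ×ˢ F₂) with hS
  have hDS : fiberComponent I₁ I₂ f₁ f₂ F₁ F₂ = closure S := rfl
  have hSU : ∀ q ∈ U, q ∈ S ↔ cmap I₁ e₁ q.1 ∈ openFace J₁ ∧ cmap I₂ e₂ q.2 ∈ openFace J₂ ∧
      f₁ q.1 = f₂ q.2 := by
    intro q hqU
    obtain ⟨-, ⟨-, ⟨-, h1⟩, -⟩, -, ⟨-, h2⟩, -⟩ := hU _ hqU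
    rw [← h1, ← h2]
    constructor
    · rintro ⟨⟨h3, h4⟩, h5⟩
      have h6 := (notMem_faceBoundary_prod_iff I₁ I₂ hX₁ hX₂ hF₁ hF₂ h3).1 h5
      exact ⟨⟨h3.1, h6.1⟩, ⟨h3.2, h6.2⟩, h4⟩
    · rintro ⟨⟨h3, h4⟩, ⟨h5, h6⟩, h7⟩
      exact ⟨⟨⟨h3, h5⟩, h7⟩,
        (notMem_faceBoundary_prod_iff I₁ I₂ hX₁ hX₂ hF₁ hF₂ ⟨h3, h5⟩).2 ⟨h4, h6⟩⟩
  -- The coordinates of the target that vanish on the images of the faces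
  set A : Set ι := {j | ∃ i ∈ J₁, α j i ≠ 0} with hA
  have hA₁ : ∀ q ∈ U, cmap I₁ e₁ q.1 ∈ openFace J₁ → ∀ j,
      xcoord I (chartAt H (f₁ p₁)) j (f₁ q.1) = 0 ↔ j ∈ A := by
    intro q hqU hq j
    obtain ⟨-, ⟨h1, -⟩, -⟩ := hU _ hqU
    rw [(h1 j).2.2]
    exact mul_prod_pow_eq_zero_iff hq (h1 j).2.1
  have hA₂' : ∀ q ∈ U, cmap I₂ e₂ q.2 ∈ openFace J₂ → ∀ j,
      xcoord I (chartAt H (f₁ p₁)) j (f₂ q.2) = 0 ↔ ∃ i ∈ J₂, β j i ≠ 0 := by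
    intro q hqU hq j
    obtain ⟨-, -, ⟨h1, -⟩⟩ := hU _ hqU
    rw [(h1 j).2.2]
    exact mul_prod_pow_eq_zero_iff hq (h1 j).2.1
  have hAA : ∀ j, (∃ i ∈ J₂, β j i ≠ 0) ↔ j ∈ A := by
    intro j
    -- As p lies in the closure, some interior point near it satisfies f₁ = f₂. Vanishing of a
    -- target coordinate is constant on each open face, so this one point settles it.
    obtain ⟨q, hqU, hqS⟩ := mem_closure_iff.1 hp U hUo hpU
    obtain ⟨h1, h2, h3⟩ := (hSU q hqU).1 hqS
    rw [← hA₂' q hqU h2 j, ← hA₁ q hqU h1 j, h3]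
  have hA₂ : ∀ q ∈ U, cmap I₂ e₂ q.2 ∈ openFace J₂ → ∀ j,
      xcoord I (chartAt H (f₁ p₁)) j (f₂ q.2) = 0 ↔ j ∈ A := fun q hqU hq j =>
    (hA₂' q hqU hq j).trans (hAA j)
  -- For j ∈ A the equation is 0 = 0 and is dropped; for j ∉ A the right side is nonzero and can be
  -- divided out.
  have heq : ∀ q ∈ U, cmap I₁ e₁ q.1 ∈ openFace J₁ → cmap I₂ e₂ q.2 ∈ openFace J₂ →
      (f₁ q.1 = f₂ q.2 ↔
        ∀ j ∉ A, c j q * ∏ s, xcoord (I₁.prod I₂) e s q ^ γ j s = 1) := by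
    intro q hqU hq₁ hq₂
    obtain ⟨-, ⟨h1, -, h1s⟩, ⟨h2, -, h2s⟩⟩ := hU _ hqU
    have h3 : f₁ q.1 = f₂ q.2 ↔ ∀ j, xcoord I (chartAt H (f₁ p₁)) j (f₁ q.1) =
        xcoord I (chartAt H (f₁ p₁)) j (f₂ q.2) := by
      refine ⟨fun h j => by rw [h], fun h => ?_⟩
      rw [← cinv_cmap I h1s, ← cinv_cmap I h2s]
      exact congrArg _ (funext h)
    have h4 : (fun s => xcoord (I₁.prod I₂) e s q) =
        Sum.elim (cmap I₁ e₁ q.1) (cmap I₂ e₂ q.2) := by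
      funext s
      rcases s with i | i <;> rfl
    rw [h3]
    refine forall_congr' fun j => ?_
    by_cases hj : j ∈ A
    · simp only [hj, not_true_eq_false, false_imp_iff, iff_true]
      rw [(hA₁ q hqU hq₁ j).2 hj, (hA₂ q hqU hq₂ j).2 hj]
    · simp only [hj, not_false_eq_true, true_imp_iff]
      have h5 := (hA₂ q hqU hq₂ j).not.2 hj
      rw [(h2 j).2.2] at h5
      have h6 := mul_prod_zpow_sum_eq_one_iff (x := cmap I₁ e₁ q.1)
        (z := cmap I₂ e₂ q.2) (α := α j) (a := a j q.1) h5
      rw [(h1 j).2.2, (h2 j).2.2]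
      refine Iff.trans ?_ (h6.symm.trans ?_)
      · rfl
      · rw [← h4]
  set J : Set (ι₁ ⊕ ι₂) := Sum.inl '' J₁ ∪ Sum.inr '' J₂ with hJ
  have hJl : ∀ i, Sum.inl i ∈ J ↔ i ∈ J₁ := fun i => by simp [hJ]
  have hJr : ∀ i, Sum.inr i ∈ J ↔ i ∈ J₂ := fun i => by simp [hJ]
  have hGU : ∀ q ∈ U, q ∈ F₁ ×ˢ F₂ ↔ ∀ s ∈ J, xcoord (I₁.prod I₂) e s q = 0 := by
    intro q hqU
    obtain ⟨-, ⟨-, ⟨h1, -⟩, -⟩, -, ⟨h2, -⟩, -⟩ := hU _ hqU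
    rw [Set.mem_prod, h1, h2, Sum.forall]
    simp only [hJl, hJr]
    rfl
  have hsrc : (e.restr U).source = U := by
    rw [e.restr_source' U hUo]
    exact inter_eq_right.2 fun x hx => (hU _ hx).1.1
  let g : Fin (Fintype.card {j // j ∉ A}) ≃ {j // j ∉ A} := (Fintype.equivFin _).symm
  refine ⟨e.restr U, restr_mem_maximalAtlas _ he hUo, ?_, J, ?_, Fintype.card {j // j ∉ A},
    fun k => c (g k), fun k => γ (g k), ?_, ?_, ?_, ?_, ?_⟩
  · rw [hsrc]; exact hpU
  · rw [hsrc]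
    ext q
    exact ⟨fun h => ⟨h.2, (hGU q h.2).1 h.1⟩, fun h => ⟨(hGU q h.1).2 h.2, h.1⟩⟩
  · rw [hsrc]
    intro k q hqU
    obtain ⟨-, ⟨h1, -⟩, ⟨h2, -⟩⟩ := hU _ hqU
    exact (hcs q (g k) (h1 _).1 (h2 _).1 (h2 _).2.1).contMDiffWithinAt
  · rw [hsrc]
    intro k q hqU
    obtain ⟨-, ⟨h1, -⟩, ⟨h2, -⟩⟩ := hU _ hqU
    exact div_pos (h1 _).2.1 (h2 _).2.1
  · rintro k (i | i) hi
    · have h1 : ¬ ∃ i ∈ J₁, α (g k) i ≠ 0 := (g k).2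
      push Not at h1
      simpa [hγ] using h1 i ((hJl i).1 hi)
    · have h1 : ¬ ∃ i ∈ J₂, β (g k) i ≠ 0 := (hAA _).not.2 (g k).2
      push Not at h1
      simpa [hγ] using h1 i ((hJr i).1 hi)
  · rw [hsrc]
    rintro q ⟨-, hqU⟩
    -- Discarding the indices in A leaves a subfamily of an independent family.
    exact (hU _ hqU).1.2.comp (fun k => (g k : ι)) (Subtype.val_injective.comp g.injective)
  · rw [hsrc, hDS, ← closure_inter_open_inter S hUo]
    congr 2
    ext q
    have key : ∀ q ∈ U, q ∈ S ↔ q ∈ F₁ ×ˢ F₂ ∧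
        (∀ s ∉ J, 0 < xcoord (I₁.prod I₂) e s q) ∧
          ∀ k, c (g k) q * ∏ s, xcoord (I₁.prod I₂) e s q ^ γ (g k) s = 1 := by
      intro q hqU
      have h1 : (∀ k, c (g k) q * ∏ s, xcoord (I₁.prod I₂) e s q ^ γ (g k) s = 1) ↔
          ∀ j ∉ A, c j q * ∏ s, xcoord (I₁.prod I₂) e s q ^ γ j s = 1 :=
        ⟨fun h j hj => by simpa using h (g.symm ⟨j, hj⟩), fun h k => h _ (g k).2⟩
      have h2 : cmap I₁ e₁ q.1 ∈ openFace J₁ ∧ cmap I₂ e₂ q.2 ∈ openFace J₂ ↔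
          q ∈ F₁ ×ˢ F₂ ∧ ∀ s ∉ J, 0 < xcoord (I₁.prod I₂) e s q := by
        rw [hGU q hqU, Sum.forall, Sum.forall]
        simp only [hJl, hJr]
        constructor
        · rintro ⟨h3, h4⟩
          exact ⟨⟨fun i => (h3 i).1, fun i => (h4 i).1⟩, fun i => (h3 i).2, fun i => (h4 i).2⟩
        · rintro ⟨⟨h3, h4⟩, h5, h6⟩
          exact ⟨fun i => ⟨h3 i, h5 i⟩, fun i => ⟨h4 i, h6 i⟩⟩
      rw [hSU q hqU, h1, ← and_assoc, ← and_assoc, ← h2]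
      exact and_congr_right fun h3 => heq q hqU h3.1 h3.2
    constructor
    · rintro ⟨hq, hqU⟩
      obtain ⟨h1, h2⟩ := (key q hqU).1 hq
      exact ⟨⟨h1, hqU⟩, h2⟩
    · rintro ⟨⟨h1, hqU⟩, h2⟩
      exact ⟨(key q hqU).2 ⟨h1, h2⟩, hqU⟩

/-- The fiber product is the union of the sets `D(F₁, F₂)`. -/
lemma fiberProduct_eq_iUnion_fiberComponent [T2Space Y]
    (hX₁ : HasEmbeddedHypersurfaces I₁ X₁) (hX₂ : HasEmbeddedHypersurfaces I₂ X₂)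
    {f₁ : X₁ → Y} {f₂ : X₂ → Y} (hf₁ : Continuous f₁) (hf₂ : Continuous f₂) :
    fiberProduct f₁ f₂ univ univ =
      ⋃ F₁ ∈ faces I₁ X₁, ⋃ F₂ ∈ faces I₂ X₂, fiberComponent I₁ I₂ f₁ f₂ F₁ F₂ := by
  apply Subset.antisymm
  · rintro ⟨p₁, p₂⟩ ⟨-, hp⟩
    -- Taking faces of the codimensions of p₁ and p₂ keeps the point off the boundary of F₁ × F₂, so
    -- no limit is needed.
    obtain ⟨F₁, hF₁, hp₁⟩ := exists_isFaceOfCodim I₁ p₁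
    obtain ⟨F₂, hF₂, hp₂⟩ := exists_isFaceOfCodim I₂ p₂
    simp only [mem_iUnion]
    refine ⟨F₁, ⟨_, hF₁⟩, F₂, ⟨_, hF₂⟩, subset_closure ⟨⟨⟨hp₁, hp₂⟩, hp⟩, ?_⟩⟩
    exact (notMem_faceBoundary_prod_iff I₁ I₂ hX₁ hX₂ hF₁ hF₂ ⟨hp₁, hp₂⟩).2 ⟨rfl, rfl⟩
  · simp only [iUnion_subset_iff]
    rintro F₁ ⟨k₁, hF₁⟩ F₂ ⟨k₂, hF₂⟩ p hp
    obtain ⟨-, h⟩ := fiberComponent_subset_fiberProduct hf₁ hf₂ hF₁.isClosed hF₂.isClosed hp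
    exact ⟨⟨trivial, trivial⟩, h⟩

end FiberProduct

end BFiber

theorem propositionP {n₁ n₂ m : ℕ} {X₁ X₂ Y : Type*}
    [TopologicalSpace X₁] [T2Space X₁] [ParacompactSpace X₁]
    [ChartedSpace (EuclideanQuadrant n₁) X₁] [IsManifold (𝓠 n₁) ∞ X₁]
    [TopologicalSpace X₂] [T2Space X₂] [ParacompactSpace X₂]
    [ChartedSpace (EuclideanQuadrant n₂) X₂] [IsManifold (𝓠 n₂) ∞ X₂]
    [TopologicalSpace Y] [T2Space Y] [ParacompactSpace Y]
    [ChartedSpace (EuclideanQuadrant m) Y] [IsManifold (𝓠 m) ∞ Y]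
    (hX₁ : BFiber.HasEmbeddedHypersurfaces (𝓠 n₁) X₁)
    (hX₂ : BFiber.HasEmbeddedHypersurfaces (𝓠 n₂) X₂)
    (hY : BFiber.HasEmbeddedHypersurfaces (𝓠 m) Y)
    (f₁ : X₁ → Y) (f₂ : X₂ → Y)
    (hf₁ : BFiber.IsInteriorBMap (𝓠 n₁) (𝓠 m) f₁)
    (hf₂ : BFiber.IsInteriorBMap (𝓠 n₂) (𝓠 m) f₂)
    (hf : BFiber.BTransversal (𝓠 n₁) (𝓠 n₂) (𝓠 m) f₁ f₂) :
    (BFiber.fiberProduct f₁ f₂ Set.univ Set.univ =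
      ⋃ F₁ ∈ BFiber.faces (𝓠 n₁) X₁, ⋃ F₂ ∈ BFiber.faces (𝓠 n₂) X₂,
        BFiber.fiberComponent (𝓠 n₁) (𝓠 n₂) f₁ f₂ F₁ F₂) ∧
    ∀ F₁ ∈ BFiber.faces (𝓠 n₁) X₁, ∀ F₂ ∈ BFiber.faces (𝓠 n₂) X₂,
      BFiber.fiberComponent (𝓠 n₁) (𝓠 n₂) f₁ f₂ F₁ F₂ ⊆ F₁ ×ˢ F₂ ∧
      (∀ p ∈ BFiber.fiberComponent (𝓠 n₁) (𝓠 n₂) f₁ f₂ F₁ F₂,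
        BFiber.HasLocalBinomialStructureAt ((𝓠 n₁).prod (𝓠 n₂)) (F₁ ×ˢ F₂)
          (BFiber.fiberComponent (𝓠 n₁) (𝓠 n₂) f₁ f₂ F₁ F₂) p) ∧
      ∀ p ∈ BFiber.fiberComponent (𝓠 n₁) (𝓠 n₂) f₁ f₂ F₁ F₂,
        BFiber.IsInteriorBinomialSubvariety ((𝓠 n₁).prod (𝓠 n₂)) (F₁ ×ˢ F₂)
          (connectedComponentIn (BFiber.fiberComponent (𝓠 n₁) (𝓠 n₂) f₁ f₂ F₁ F₂) p) := by
  have hc₁ := hf₁.contMDiff.continuous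
  have hc₂ := hf₂.contMDiff.continuous
  refine ⟨BFiber.fiberProduct_eq_iUnion_fiberComponent hX₁ hX₂ hc₁ hc₂, ?_⟩
  rintro F₁ ⟨k₁, hF₁⟩ F₂ ⟨k₂, hF₂⟩
  have hsub : BFiber.fiberComponent (𝓠 n₁) (𝓠 n₂) f₁ f₂ F₁ F₂ ⊆ F₁ ×ˢ F₂ := fun p hp =>
    (BFiber.fiberComponent_subset_fiberProduct hc₁ hc₂ hF₁.isClosed hF₂.isClosed hp).1
  have hloc := fun p (hp : p ∈ BFiber.fiberComponent (𝓠 n₁) (𝓠 n₂) f₁ f₂ F₁ F₂) =>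
    BFiber.hasLocalBinomialStructureAt_fiberComponent hX₁ hX₂ hf₁ hf₂ hf hF₁ hF₂ hp
  exact ⟨hsub, hloc, fun p hp =>
    BFiber.isInteriorBinomialSubvariety_connectedComponentIn isClosed_closure hsub hloc hp⟩
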